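/- Let $p$ be a prime, let $S$ be a finite $p$-group and let $\mathcal F$ be a saturated fusion system over $S$. Let $A$ be a cyclic $p$-group, regarded as a subgroup of $S^1$ through an injective homomorphism $\iota\colon A\to S^1$. Let $\alpha\colon S\times S\to A$ be a normalized $2$-cocycle (trivial action), and let $S_\alpha$ be the set $A\times S$ with the product $(a,s)(b,t)=(ab\,\alpha(s,t),st)$, a central extension of $S$ by $A$ with projection $\pi\colon S_\alpha\to S$. Let $\mathcal F_\alpha$ be a central extension of $\mathcal F$ by $A$ over $S_\alpha$, that is, a saturated fusion system over $S_\alpha$ such that * $A$ is contained in the center of $\mathcal F_\alpha$, the group of those $z\in Z(S_\alpha)$ with $f(z)=z$ for all morphisms $f$ of $\mathcal F_\alpha$ between $\mathcal F_\alpha$-centric subgroups (equivalently $\lim_{\mathcal F_\alpha^c}Z(-)$), and * $\mathcal F_\alpha/A=\mathcal F$: for $P,Q\le S$, the morphisms $P\to Q$ of $\mathcal F$ are exactly the homomorphisms induced by the morphisms $\pi^{-1}(P)\to\pi^{-1}(Q)$ of $\mathcal F_\alpha$. (In particular $\mathcal F_\alpha$ may be the fusion system of the central extension $(S_\alpha,\mathcal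 F_\alpha,\mathcal L_\alpha)$ of a $p$-local finite group $(S,\mathcal F,\mathcal L)$ determined by a $2$-cocycle $\alpha$ for $(S,\mathcal F,\mathcal L)$ with values in $A$.) Let $R(\mathcal F)$ be the Grothendieck ring of the semiring of isomorphism classes of finite-dimensional complex representations $V$ of $S$ that are $\mathcal F$-invariant ($V|_P\cong f^*V$ for all $P\le S$ and all morphisms $f\colon P\to S$ of $\mathcal F$). An $A$-representation of a subgroup $Q\le S_\alpha$ is a finite-dimensional complex representation on which every $a\in A\cap Q$ acts as multiplication by $\iota(a)$; let $R(Q;A)$ be the Grothendieck group of the monoid of isomorphism classes of $A$-representations of $Q$ under direct sum, and let $R(\mathcal F_\alpha;A)$ be the Grothendieck group of the monoid of isomorphism classes of $\mathcal F_\alpha$-invariant $A$-representations of $S_\alpha$. These are $R(\mathcal F)$-modules by $(V,W)\mapsto V\otimes W$, where $S_\alpha$ and its subgroups act on $V$ through $\pi$. Let $\mathrm{Or}(\mathcal F_\alpha^c)$ be the category with the $\mathcal F_\alpha$-centric subgroups of $S_\alpha$ as objects and $\mathrm{Hom}(P,Q)=\mathrm{Hom}_{\mathcal F_\alpha}(P,Q)/\mathrm{Inn}(Q)$.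 Restriction along morphisms makes $Q\mapsto R(Q;A)$ a contravariant functor from $\mathrm{Or}(\mathcal F_\alpha^c)$ to $R(\mathcal F)$-modules. Then the restriction maps $R(\mathcal F_\alpha;A)\to R(Q;A)$ induce an isomorphism of $R(\mathcal F)$-modules $$R(\mathcal F_\alpha;A)\;\cong\;\lim_{\mathrm{Or}(\mathcal F_\alpha^c)}R(Q;A).$$ -/

import Mathlib

universe u v

/-! ### Grothendieck groups of semirings and of semimodules -/

namespace Groth

open Algebra

/-- The homomorphism of Grothendieck groups induced by a homomorphism of commutative monoids. -/
noncomputable def map {M N : Type*} [AddCommMonoid M] [AddCommMonoid N] (f : M →+ N) :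
    GrothendieckAddGroup M →+ GrothendieckAddGroup N :=
  GrothendieckAddGroup.lift (GrothendieckAddGroup.of.comp f)

theorem map_of {M N : Type*} [AddCommMonoid M] [AddCommMonoid N] (f : M →+ N) (m : M) :
    map f (GrothendieckAddGroup.of m) = GrothendieckAddGroup.of (f m) :=
  DFunLike.congr_fun (GrothendieckAddGroup.lift.symm_apply_apply
    (GrothendieckAddGroup.of.comp f)) m

theorem hom_ext {M H : Type*} [AddCommMonoid M] [AddCommGroup H]
    {f g : GrothendieckAddGroup M →+ H}
    (h : ∀ m, f (GrothendieckAddGroup.of m) = g (GrothendieckAddGroup.of m)) : f = g :=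
  GrothendieckAddGroup.lift.symm.injective (AddMonoidHom.ext h)

/-- The biadditive extension of the action of a semiring `R` on a semimodule `M` to the
Grothendieck groups. -/
noncomputable def act (R M : Type*) [Semiring R] [AddCommMonoid M] [Module R M] :
    GrothendieckAddGroup R →+ GrothendieckAddGroup M →+ GrothendieckAddGroup M :=
  GrothendieckAddGroup.lift
    { toFun := fun r => map (DistribSMul.toAddMonoidHom M r)
      map_zero' := hom_ext fun m => by
        rw [map_of, DistribSMul.toAddMonoidHom_apply, zero_smul, map_zero]; rfl
      map_add' := fun r s => hom_ext fun m => by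
        rw [AddMonoidHom.add_apply, map_of, map_of, map_of]
        simp only [DistribSMul.toAddMonoidHom_apply, add_smul, map_add] }

theorem act_of_of (R M : Type*) [Semiring R] [AddCommMonoid M] [Module R M] (r : R) (m : M) :
    act R M (GrothendieckAddGroup.of r) (GrothendieckAddGroup.of m)
      = GrothendieckAddGroup.of (r • m) := by
  refine Eq.trans ?_ (map_of (DistribSMul.toAddMonoidHom M r) m)
  exact DFunLike.congr_fun (DFunLike.congr_fun
    (GrothendieckAddGroup.lift.symm_apply_apply _) r) (GrothendieckAddGroup.of m)

theorem induction {M : Type*} [AddCommMonoid M] {C : GrothendieckAddGroup M → Prop}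
    (x : GrothendieckAddGroup M) (of : ∀ m, C (GrothendieckAddGroup.of m))
    (sub : ∀ a b, C a → C b → C (a - b)) : C x := by
  induction x using AddLocalization.ind with
  | H y =>
    obtain ⟨m, n, hn⟩ := y
    have : AddLocalization.mk m ⟨n, hn⟩
        = GrothendieckAddGroup.of m - GrothendieckAddGroup.of n := by
      have h1 : ∀ k : M, (GrothendieckAddGroup.of k : GrothendieckAddGroup M)
        = AddLocalization.mk k 0 := fun k => (AddLocalization.mk_zero_eq_addMonoidOf_mk k).symm
      rw [h1, h1, GrothendieckAddGroup.mk_sub_mk]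
      simp
    rw [this]
    exact sub _ _ (of _) (of _)

theorem act_assoc {R M : Type*} [Semiring R] [AddCommMonoid M] [Module R M]
    (x y : GrothendieckAddGroup R) (z : GrothendieckAddGroup M) :
    act R M (act R R x y) z = act R M x (act R M y z) := by
  induction x using induction with
  | sub a b ha hb => simp only [map_sub, AddMonoidHom.sub_apply, ha, hb]
  | of r =>
    induction y using induction with
    | sub a b ha hb => simp only [map_sub, AddMonoidHom.sub_apply, ha, hb]
    | of s =>
      induction z using induction with
      | sub a b ha hb => simp only [map_sub, ha, hb]
      | of m => simp only [act_of_of, smul_eq_mul, mul_smul]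

theorem one_act {R M : Type*} [Semiring R] [AddCommMonoid M] [Module R M]
    (z : GrothendieckAddGroup M) : act R M (GrothendieckAddGroup.of 1) z = z := by
  induction z using induction with
  | sub a b ha hb => simp only [map_sub, ha, hb]
  | of m => rw [act_of_of, one_smul]

theorem act_comm {R : Type*} [CommSemiring R] (x y : GrothendieckAddGroup R) :
    act R R x y = act R R y x := by
  induction x using induction with
  | sub a b ha hb => simp only [map_sub, AddMonoidHom.sub_apply, ha, hb]
  | of r =>
    induction y using induction with
    | sub a b ha hb => simp only [map_sub, AddMonoidHom.sub_apply, ha, hb]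
    | of s => simp only [act_of_of, smul_eq_mul, mul_comm]

/-- The Grothendieck ring of a commutative semiring. -/
noncomputable instance instCommRing (R : Type*) [CommSemiring R] :
    CommRing (GrothendieckAddGroup R) :=
  { GrothendieckAddGroup.instAddCommGroup with
    mul := fun x y => act R R x y
    one := GrothendieckAddGroup.of 1
    mul_assoc := act_assoc
    one_mul := one_act
    mul_one := fun x => (act_comm _ _).trans (one_act x)
    mul_comm := act_comm
    left_distrib := fun x y z => map_add (act R R x) y z
    right_distrib := fun x y z => by
      change act R R (x + y) z = _
      rw [map_add]; rfl
    zero_mul := fun x => by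
      change act R R 0 x = _
      rw [map_zero]; rfl
    mul_zero := fun x => map_zero (act R R x) }

/-- The Grothendieck group of a semimodule over a commutative semiring, as a module over the
Grothendieck ring. -/
noncomputable instance instModule (R M : Type*) [CommSemiring R] [AddCommMonoid M] [Module R M] :
    Module (GrothendieckAddGroup R) (GrothendieckAddGroup M) where
  smul x y := act R M x y
  one_smul := one_act
  mul_smul := act_assoc
  smul_zero x := map_zero (act R M x)
  smul_add x := map_add (act R M x)
  add_smul x y z := by
    change act R M (x + y) z = _
    rw [map_add]; rfl
  zero_smul z := by
    change act R M 0 z = _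
    rw [map_zero]; rfl

theorem of_smul_of {R M : Type*} [CommSemiring R] [AddCommMonoid M] [Module R M] (r : R) (m : M) :
    (GrothendieckAddGroup.of r : GrothendieckAddGroup R) •
      (GrothendieckAddGroup.of m : GrothendieckAddGroup M) = GrothendieckAddGroup.of (r • m) :=
  act_of_of R M r m

/-- The linear map of Grothendieck groups induced by a linear map of semimodules. -/
noncomputable def mapLinear {R M N : Type*} [CommSemiring R] [AddCommMonoid M] [AddCommMonoid N]
    [Module R M] [Module R N] (f : M →ₗ[R] N) :
    GrothendieckAddGroup M →ₗ[GrothendieckAddGroup R] GrothendieckAddGroup N where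
  toFun := map f.toAddMonoidHom
  map_add' := map_add _
  map_smul' x y := by
    simp only [RingHom.id_apply]
    change map f.toAddMonoidHom (act R M x y) = act R N x (map f.toAddMonoidHom y)
    induction x using induction with
    | sub a b ha hb => simp only [map_sub, AddMonoidHom.sub_apply, ha, hb]
    | of r =>
      induction y using induction with
      | sub a b ha hb => simp only [map_sub, ha, hb]
      | of m =>
        rw [act_of_of, map_of, map_of, act_of_of]
        exact congrArg _ (f.map_smul r m)

theorem mapLinear_of {R M N : Type*} [CommSemiring R] [AddCommMonoid M] [AddCommMonoid N]
    [Module R M] [Module R N] (f : M →ₗ[R] N) (m : M) :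
    mapLinear f (GrothendieckAddGroup.of m) = GrothendieckAddGroup.of (f m) := map_of _ m

theorem linear_ext {R M N : Type*} [CommSemiring R] [AddCommMonoid M] [Module R M]
    [AddCommGroup N] [Module (GrothendieckAddGroup R) N]
    {f g : GrothendieckAddGroup M →ₗ[GrothendieckAddGroup R] N}
    (h : ∀ m, f (GrothendieckAddGroup.of m) = g (GrothendieckAddGroup.of m)) : f = g := by
  ext x
  induction x using induction with
  | sub a b ha hb => simp only [map_sub, ha, hb]
  | of m => exact h m

theorem mapLinear_id {R M : Type*} [CommSemiring R] [AddCommMonoid M] [Module R M] :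
    mapLinear (LinearMap.id : M →ₗ[R] M) = LinearMap.id :=
  linear_ext fun m => mapLinear_of _ m

theorem mapLinear_comp {R M N L : Type*} [CommSemiring R] [AddCommMonoid M] [AddCommMonoid N]
    [AddCommMonoid L] [Module R M] [Module R N] [Module R L] (g : N →ₗ[R] L) (f : M →ₗ[R] N) :
    mapLinear g ∘ₗ mapLinear f = mapLinear (g ∘ₗ f) :=
  linear_ext fun m => by
    rw [LinearMap.comp_apply, mapLinear_of, mapLinear_of, mapLinear_of]
    rfl

end Groth

/-! ### Isomorphism classes of finite-dimensional complex representations -/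

/-- A finite-dimensional complex representation of `G`, on some `ℂⁿ`. -/
structure FinRep (G : Type u) [Group G] where
  n : ℕ
  ρ : Representation ℂ G (Fin n → ℂ)

namespace FinRep

/-- Isomorphism of representations. -/
instance setoid (G : Type u) [Group G] : Setoid (FinRep G) where
  r V W := Nonempty (V.ρ.Equiv W.ρ)
  iseqv := ⟨fun V => ⟨.refl V.ρ⟩, fun ⟨e⟩ => ⟨e.symm⟩, fun ⟨e⟩ ⟨f⟩ => ⟨e.trans f⟩⟩

/-- A representation on a finite-dimensional space `V`, moved to `ℂⁿ` with `n = dim V`. -/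
noncomputable def ofRep {G : Type u} [Group G] {V : Type v} [AddCommGroup V] [Module ℂ V]
    [FiniteDimensional ℂ V] (ρ : Representation ℂ G V) : FinRep G where
  n := Module.finrank ℂ V
  ρ := ((Module.finBasis ℂ V).equivFun.conjRingEquiv : _ →* _).comp ρ

/-- `ofRep ρ` is isomorphic to `ρ`. -/
noncomputable def ofRepEquiv {G : Type u} [Group G] {V : Type v} [AddCommGroup V] [Module ℂ V]
    [FiniteDimensional ℂ V] (ρ : Representation ℂ G V) : ρ.Equiv (ofRep ρ).ρ :=
  .mk (Module.finBasis ℂ V).equivFun fun g => by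
    refine LinearMap.ext fun x => ?_
    change _ = (Module.finBasis ℂ V).equivFun (ρ g ((Module.finBasis ℂ V).equivFun.symm
      ((Module.finBasis ℂ V).equivFun x)))
    rw [LinearEquiv.symm_apply_apply]
    rfl

end FinRep

/-- The set of isomorphism classes of finite-dimensional complex representations of `G`. -/
def RepClass (G : Type u) [Group G] : Type u := Quotient (FinRep.setoid G)

namespace RepClass

open TensorProduct

variable {G : Type u} [Group G]

/-- The isomorphism class of a finite-dimensional representation. -/
noncomputable def cls {V : Type v} [AddCommGroup V] [Module ℂ V] [FiniteDimensional ℂ V]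
    (ρ : Representation ℂ G V) : RepClass G := Quotient.mk _ (FinRep.ofRep ρ)

theorem cls_eq_iff {V W : Type*} [AddCommGroup V] [Module ℂ V] [FiniteDimensional ℂ V]
    [AddCommGroup W] [Module ℂ W] [FiniteDimensional ℂ W]
    {ρ : Representation ℂ G V} {σ : Representation ℂ G W} :
    cls ρ = cls σ ↔ Nonempty (ρ.Equiv σ) := by
  refine Quotient.eq.trans ⟨fun ⟨e⟩ => ?_, fun ⟨e⟩ => ?_⟩
  · exact ⟨((FinRep.ofRepEquiv ρ).trans e).trans (FinRep.ofRepEquiv σ).symm⟩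
  · exact ⟨((FinRep.ofRepEquiv ρ).symm.trans e).trans (FinRep.ofRepEquiv σ)⟩

theorem mk_eq_cls (V : FinRep G) : (Quotient.mk _ V : RepClass G) = cls V.ρ :=
  Quotient.sound ⟨FinRep.ofRepEquiv V.ρ⟩

theorem ind {C : RepClass G → Prop}
    (h : ∀ (n : ℕ) (ρ : Representation ℂ G (Fin n → ℂ)), C (cls ρ)) (x : RepClass G) : C x := by
  induction x using Quotient.ind with
  | _ V => rw [mk_eq_cls]; exact h _ _

theorem equiv_apply {V W : Type*} [AddCommGroup V] [Module ℂ V] [AddCommGroup W] [Module ℂ W]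
    {ρ : Representation ℂ G V} {σ : Representation ℂ G W} (e : ρ.Equiv σ) (g : G) (v : V) :
    e.toLinearEquiv (ρ g v) = σ g (e.toLinearEquiv v) :=
  LinearMap.congr_fun (e.isIntertwining' g) v

/-- An isomorphism of direct sums from isomorphisms of the summands. -/
noncomputable def prodCongr {V V' W W' : Type*} [AddCommGroup V] [Module ℂ V] [AddCommGroup V']
    [Module ℂ V'] [AddCommGroup W] [Module ℂ W] [AddCommGroup W'] [Module ℂ W']
    {ρ : Representation ℂ G V} {ρ' : Representation ℂ G V'}
    {σ : Representation ℂ G W} {σ' : Representation ℂ G W'}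
    (e : ρ.Equiv ρ') (f : σ.Equiv σ') : (ρ.prod σ).Equiv (ρ'.prod σ') :=
  .mk (e.toLinearEquiv.prodCongr f.toLinearEquiv) fun g =>
    LinearMap.ext fun x => Prod.ext (equiv_apply e g x.1) (equiv_apply f g x.2)

/-- An isomorphism of tensor products from isomorphisms of the factors. -/
noncomputable def tprodCongr {V V' W W' : Type*} [AddCommGroup V] [Module ℂ V] [AddCommGroup V']
    [Module ℂ V'] [AddCommGroup W] [Module ℂ W] [AddCommGroup W'] [Module ℂ W']
    {ρ : Representation ℂ G V} {ρ' : Representation ℂ G V'}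
    {σ : Representation ℂ G W} {σ' : Representation ℂ G W'}
    (e : ρ.Equiv ρ') (f : σ.Equiv σ') : (ρ.tprod σ).Equiv (ρ'.tprod σ') :=
  .mk (TensorProduct.congr e.toLinearEquiv f.toLinearEquiv) fun g =>
    TensorProduct.ext' fun x y =>
      congrArg₂ (TensorProduct.tmul ℂ) (equiv_apply e g x) (equiv_apply f g y)

/-- Restriction along a group homomorphism preserves isomorphisms. -/
def compEquiv {H : Type*} [Group H] {V W : Type*} [AddCommGroup V] [Module ℂ V] [AddCommGroup W]
    [Module ℂ W] {ρ : Representation ℂ H V} {σ : Representation ℂ H W} (φ : G →* H)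
    (e : ρ.Equiv σ) : Representation.Equiv (MonoidHom.comp ρ φ) (MonoidHom.comp σ φ) :=
  .mk e.toLinearEquiv fun g => LinearMap.ext fun x => equiv_apply e (φ g) x

/-- Direct sum. -/
noncomputable instance : Add (RepClass G) where
  add := Quotient.map₂ (fun V W => FinRep.ofRep (V.ρ.prod W.ρ)) fun _ _ ⟨e⟩ _ _ ⟨f⟩ =>
    ⟨((FinRep.ofRepEquiv _).symm.trans (prodCongr e f)).trans (FinRep.ofRepEquiv _)⟩

/-- Tensor product. -/
noncomputable instance : Mul (RepClass G) where
  mul := Quotient.map₂ (fun V W => FinRep.ofRep (V.ρ.tprod W.ρ)) fun _ _ ⟨e⟩ _ _ ⟨f⟩ =>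
    ⟨((FinRep.ofRepEquiv _).symm.trans (tprodCongr e f)).trans (FinRep.ofRepEquiv _)⟩

/-- The zero representation. -/
noncomputable instance : Zero (RepClass G) := ⟨cls (Representation.trivial ℂ G (Fin 0 → ℂ))⟩

/-- The trivial one-dimensional representation. -/
noncomputable instance : One (RepClass G) := ⟨cls (Representation.trivial ℂ G ℂ)⟩

theorem cls_add {V W : Type*} [AddCommGroup V] [Module ℂ V] [FiniteDimensional ℂ V]
    [AddCommGroup W] [Module ℂ W] [FiniteDimensional ℂ W]
    (ρ : Representation ℂ G V) (σ : Representation ℂ G W) :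
    cls ρ + cls σ = cls (ρ.prod σ) :=
  cls_eq_iff.2 ⟨prodCongr (FinRep.ofRepEquiv ρ).symm (FinRep.ofRepEquiv σ).symm⟩

theorem cls_mul {V W : Type*} [AddCommGroup V] [Module ℂ V] [FiniteDimensional ℂ V]
    [AddCommGroup W] [Module ℂ W] [FiniteDimensional ℂ W]
    (ρ : Representation ℂ G V) (σ : Representation ℂ G W) :
    cls ρ * cls σ = cls (ρ.tprod σ) :=
  cls_eq_iff.2 ⟨tprodCongr (FinRep.ofRepEquiv ρ).symm (FinRep.ofRepEquiv σ).symm⟩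

theorem cls_eq_zero {V : Type*} [AddCommGroup V] [Module ℂ V] [Subsingleton V]
    (ρ : Representation ℂ G V) : cls ρ = 0 :=
  cls_eq_iff.2 ⟨.mk ((0 : V ≃ₗ[ℂ] (Fin 0 → ℂ))) fun _ =>
    LinearMap.ext fun _ => Subsingleton.elim _ _⟩

/-- The semiring of isomorphism classes of representations. -/
noncomputable instance : CommSemiring (RepClass G) :=
  let add : AddCommMonoid (RepClass G) :=
    { nsmul := nsmulRec
      add_assoc := by
        refine ind fun _ ρ => ind fun _ σ => ind fun _ τ => ?_
        simp only [cls_add]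
        exact cls_eq_iff.2 ⟨.mk (LinearEquiv.prodAssoc ℂ _ _ _) fun _ => rfl⟩
      zero_add := by
        refine ind fun _ ρ => ?_
        exact (cls_add _ _).trans (cls_eq_iff.2 ⟨.mk LinearEquiv.uniqueProd fun g => rfl⟩)
      add_zero := by
        refine ind fun _ ρ => ?_
        exact (cls_add _ _).trans (cls_eq_iff.2 ⟨.mk LinearEquiv.prodUnique fun g => rfl⟩)
      add_comm := by
        refine ind fun _ ρ => ind fun _ σ => ?_
        simp only [cls_add]
        exact cls_eq_iff.2 ⟨.mk (LinearEquiv.prodComm ℂ _ _) fun g => rfl⟩ }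
  let mul : CommMonoid (RepClass G) :=
    { mul_assoc := by
        refine ind fun _ ρ => ind fun _ σ => ind fun _ τ => ?_
        simp only [cls_mul]
        exact cls_eq_iff.2 ⟨Representation.TensorProduct.assoc _ _ _⟩
      one_mul := by
        refine ind fun _ ρ => ?_
        exact (cls_mul _ _).trans (cls_eq_iff.2 ⟨Representation.TensorProduct.lid _ _⟩)
      mul_one := by
        refine ind fun _ ρ => ?_
        exact (cls_mul _ _).trans (cls_eq_iff.2 ⟨Representation.TensorProduct.rid _ _⟩)
      mul_comm := by
        refine ind fun _ ρ => ind fun _ σ => ?_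
        simp only [cls_mul]
        exact cls_eq_iff.2 ⟨Representation.TensorProduct.comm _ _⟩ }
  { add, mul with
    left_distrib := by
      refine ind fun _ ρ => ind fun _ σ => ind fun _ τ => ?_
      simp only [cls_add, cls_mul]
      exact cls_eq_iff.2 ⟨.mk (TensorProduct.prodRight ℂ ℂ _ _ _) fun g =>
        TensorProduct.ext' fun x y => rfl⟩
    right_distrib := by
      refine ind fun _ ρ => ind fun _ σ => ind fun _ τ => ?_
      simp only [cls_add, cls_mul]
      exact cls_eq_iff.2 ⟨.mk (TensorProduct.prodLeft ℂ ℂ _ _ _) fun g =>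
        TensorProduct.ext' fun x y => rfl⟩
    zero_mul := by
      refine ind fun _ ρ => ?_
      exact (cls_mul _ _).trans (cls_eq_zero _)
    mul_zero := by
      refine ind fun _ ρ => ?_
      exact (cls_mul _ _).trans (cls_eq_zero _) }

/-- Restriction of representations along a group homomorphism `φ`, as a map: `ρ ↦ ρ ∘ φ`. -/
noncomputable def comapFun {H : Type*} [Group H] (φ : G →* H) : RepClass H → RepClass G :=
  Quotient.map (fun V => ⟨V.n, MonoidHom.comp V.ρ φ⟩) fun _ _ ⟨e⟩ => ⟨compEquiv φ e⟩

theorem comapFun_cls {H : Type*} [Group H] (φ : G →* H) {V : Type*} [AddCommGroup V] [Module ℂ V]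
    [FiniteDimensional ℂ V] (ρ : Representation ℂ H V) :
    comapFun φ (cls ρ) = cls (MonoidHom.comp ρ φ : Representation ℂ G V) :=
  (mk_eq_cls _).trans (cls_eq_iff.2 ⟨compEquiv φ (FinRep.ofRepEquiv _).symm⟩)

/-- Restriction of representations along a group homomorphism `φ`, as a homomorphism of semirings:
`ρ ↦ ρ ∘ φ`. -/
noncomputable def comap {H : Type*} [Group H] (φ : G →* H) : RepClass H →+* RepClass G where
  toFun := comapFun φ
  map_zero' := (comapFun_cls _ _).trans (cls_eq_zero _)
  map_one' := comapFun_cls _ _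
  map_add' := by
    refine ind fun _ ρ => ind fun _ σ => ?_
    simp only [cls_add, comapFun_cls]
    rfl
  map_mul' := by
    refine ind fun _ ρ => ind fun _ σ => ?_
    simp only [cls_mul, comapFun_cls]
    rfl

theorem comap_cls {H : Type*} [Group H] (φ : G →* H) {V : Type*} [AddCommGroup V] [Module ℂ V]
    [FiniteDimensional ℂ V] (ρ : Representation ℂ H V) :
    comap φ (cls ρ) = cls (MonoidHom.comp ρ φ : Representation ℂ G V) := comapFun_cls φ ρ

theorem comap_comap {H K : Type*} [Group H] [Group K] (φ : G →* H) (ψ : H →* K) (x : RepClass K) :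
    comap φ (comap ψ x) = comap (ψ.comp φ) x := by
  induction x using ind with
  | h n ρ => simp only [comap_cls]; rfl

theorem comap_id (x : RepClass G) : comap (MonoidHom.id G) x = x := by
  induction x using ind with
  | h n ρ => simp only [comap_cls]; rfl

/-- Homomorphisms that differ by an inner automorphism of the target induce the same
restriction. -/
theorem comap_conj {H : Type*} [Group H] (φ ψ : G →* H) (h : H)
    (hh : ∀ x, ψ x = h * φ x * h⁻¹) (x : RepClass H) : comap ψ x = comap φ x := by
  induction x using ind with
  | h n ρ =>
    simp only [comap_cls]
    refine cls_eq_iff.2 ⟨.mk (LinearEquiv.ofLinearMap (ρ h⁻¹) (ρ h)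
      (by rw [← Module.End.mul_eq_comp, ← map_mul]; simp; rfl)
      (by rw [← Module.End.mul_eq_comp, ← map_mul]; simp; rfl)) fun g => ?_⟩
    change ρ h⁻¹ * ρ (ψ g) = ρ (φ g) * ρ h⁻¹
    rw [← map_mul, ← map_mul, hh]
    congr 1
    group

end RepClass

/-! ### Fusion systems -/

/-- A fusion system over a finite `p`-group `S`. The objects are the subgroups of `S`, and
`Hom P Q` is the set of morphisms from `P` to `Q`. -/
structure FusionSystem (p : ℕ) (S : Type u) [Group S] where
  finite : Finite S
  isPGroup : IsPGroup p S
  Hom : ∀ P Q : Subgroup S, Set (P →* Q)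
  comp_mem : ∀ {P Q R : Subgroup S} {f : P →* Q} {g : Q →* R},
    f ∈ Hom P Q → g ∈ Hom Q R → g.comp f ∈ Hom P R
  /-- Homomorphisms given by conjugation by an element of `S` are morphisms. -/
  conj_mem : ∀ {P Q : Subgroup S} (s : S) (f : P →* Q),
    (∀ x : P, (f x : S) = s * x * s⁻¹) → f ∈ Hom P Q
  injective : ∀ {P Q : Subgroup S} {f : P →* Q}, f ∈ Hom P Q → Function.Injective f
  /-- Every morphism is an isomorphism of the fusion system followed by an inclusion. -/
  factor : ∀ {P Q : Subgroup S} {f : P →* Q}, f ∈ Hom P Q →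
    ∃ (R : Subgroup S) (hR : R ≤ Q) (e : P ≃* R), e.toMonoidHom ∈ Hom P R ∧
      e.symm.toMonoidHom ∈ Hom R P ∧ f = (Subgroup.inclusion hR).comp e.toMonoidHom

namespace FusionSystem

variable {p : ℕ} {S : Type u} [Group S] (F : FusionSystem p S)

/-- Isomorphisms of the fusion system. -/
def IsIso {P Q : Subgroup S} (e : P ≃* Q) : Prop :=
  e.toMonoidHom ∈ F.Hom P Q ∧ e.symm.toMonoidHom ∈ F.Hom Q P

/-- Conjugacy of subgroups in the fusion system. -/
def IsConj (P Q : Subgroup S) : Prop := ∃ e : P ≃* Q, F.IsIso e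

def FullyCentralized (P : Subgroup S) : Prop :=
  ∀ P' : Subgroup S, F.IsConj P P' →
    Nat.card (Subgroup.centralizer (P' : Set S)) ≤ Nat.card (Subgroup.centralizer (P : Set S))

def FullyNormalized (P : Subgroup S) : Prop :=
  ∀ P' : Subgroup S, F.IsConj P P' →
    Nat.card (Subgroup.normalizer (P' : Set S)) ≤ Nat.card (Subgroup.normalizer (P : Set S))

theorem isIso_refl (P : Subgroup S) : F.IsIso (MulEquiv.refl P) :=
  ⟨F.conj_mem 1 _ (by simp), F.conj_mem 1 _ (by simp)⟩

variable {F} in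
theorem IsIso.symm {P Q : Subgroup S} {e : P ≃* Q} (h : F.IsIso e) : F.IsIso e.symm := ⟨h.2, h.1⟩

variable {F} in
theorem IsIso.trans {P Q R : Subgroup S} {e : P ≃* Q} {f : Q ≃* R} (h : F.IsIso e)
    (h' : F.IsIso f) : F.IsIso (e.trans f) := ⟨F.comp_mem h.1 h'.1, F.comp_mem h'.2 h.2⟩

/-- The group `Aut_F(P)`. -/
def autF (P : Subgroup S) : Subgroup (MulAut P) where
  carrier := {e | F.IsIso e}
  mul_mem' ha hb := hb.trans ha
  one_mem' := F.isIso_refl P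
  inv_mem' ha := ha.symm

/-- The group `Aut_S(P)` of automorphisms of `P` that are conjugations by elements of `S`. -/
def autS (P : Subgroup S) : Subgroup (MulAut P) := P.normalizerMonoidHom.range

/-- The subgroup `N_φ = {g ∈ N_S(P) | φ c_g φ⁻¹ ∈ Aut_S(φ P)}` for a homomorphism `φ : P → S`:
the condition on `g` is that `φ(g x g⁻¹) = h φ(x) h⁻¹` for some `h ∈ S` and all `x ∈ P`. -/
def extender {P : Subgroup S} (φ : P →* S) : Subgroup S where
  carrier := {g | ∃ hg : g ∈ Subgroup.normalizer (P : Set S), ∃ h : S, ∀ x : P,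
    φ (P.normalizerMonoidHom ⟨g, hg⟩ x) = h * φ x * h⁻¹}
  one_mem' := ⟨one_mem _, 1, fun x => by
    have : (⟨1, one_mem _⟩ : Subgroup.normalizer (P : Set S)) = 1 := rfl
    rw [this, map_one]; simp⟩
  mul_mem' := by
    rintro a b ⟨ha, k, hk⟩ ⟨hb, l, hl⟩
    refine ⟨mul_mem ha hb, k * l, fun x => ?_⟩
    have : (⟨a * b, mul_mem ha hb⟩ : Subgroup.normalizer (P : Set S)) = ⟨a, ha⟩ * ⟨b, hb⟩ := rfl
    rw [this, map_mul, MulAut.mul_apply, hk, hl]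
    group
  inv_mem' := by
    rintro a ⟨ha, k, hk⟩
    refine ⟨inv_mem ha, k⁻¹, fun x => ?_⟩
    have : (⟨a⁻¹, inv_mem ha⟩ : Subgroup.normalizer (P : Set S)) = ⟨a, ha⟩⁻¹ := rfl
    have h2 := hk (P.normalizerMonoidHom ⟨a⁻¹, inv_mem ha⟩ x)
    rw [this, map_inv, MulAut.apply_inv_self] at h2
    rw [this, map_inv, h2]
    group

/-- Saturated fusion systems. -/
structure IsSaturated : Prop where
  /-- Fully normalized subgroups are fully centralized. -/
  fullyCentralized : ∀ P : Subgroup S, F.FullyNormalized P → F.FullyCentralized P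
  /-- If `P` is fully normalized, then `Aut_S(P)` is a Sylow `p`-subgroup of `Aut_F(P)`. -/
  sylow : ∀ P : Subgroup S, F.FullyNormalized P →
    ∃ T : Sylow p (F.autF P), (T : Subgroup (F.autF P)) = (autS P).subgroupOf (F.autF P)
  /-- A morphism `φ : P → S` with fully centralized image extends to `N_φ`. -/
  extend : ∀ (P : Subgroup S) (φ : P →* (⊤ : Subgroup S)), φ ∈ F.Hom P ⊤ →
    F.FullyCentralized (φ.range.map (Subgroup.subtype ⊤)) →
      ∃ ψ ∈ F.Hom (extender ((Subgroup.subtype ⊤).comp φ)) ⊤,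
        ∀ (x : S) (hx : x ∈ P) (hx' : x ∈ extender ((Subgroup.subtype ⊤).comp φ)),
          ψ ⟨x, hx'⟩ = φ ⟨x, hx⟩

/-- `F`-centric subgroups: all the conjugates contain their centralizers in `S`. -/
def IsCentric (P : Subgroup S) : Prop :=
  ∀ P' : Subgroup S, F.IsConj P P' → Subgroup.centralizer (P' : Set S) ≤ P'

/-- The class of a representation of `S` is `F`-invariant if its restrictions along `P ≤ S` and along
`f` are isomorphic for every morphism `f : P → S` of `F`. -/
def IsInvariant (x : RepClass S) : Prop :=
  ∀ (P : Subgroup S) (f : P →* (⊤ : Subgroup S)), f ∈ F.Hom P ⊤ →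
    RepClass.comap ((Subgroup.subtype ⊤).comp f) x = RepClass.comap P.subtype x

/-- The semiring `Rep(F)` of isomorphism classes of `F`-invariant representations of `S`. -/
noncomputable def Rep : Subsemiring (RepClass S) where
  carrier := {x | F.IsInvariant x}
  mul_mem' hx hy P f hf := by rw [map_mul, map_mul, hx P f hf, hy P f hf]
  one_mem' P f hf := by rw [map_one, map_one]
  add_mem' hx hy P f hf := by rw [map_add, map_add, hx P f hf, hy P f hf]
  zero_mem' P f hf := by rw [map_zero, map_zero]

/-- The representation ring `R(F)`. -/
abbrev R : Type u := Algebra.GrothendieckAddGroup F.Rep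

/-- The restrictions of `x` along `P ≤ S` and along `e` agree. -/
def Fixes (x : RepClass S) {P Q : Subgroup S} (e : P ≃* Q) : Prop :=
  RepClass.comap (Q.subtype.comp e.toMonoidHom) x = RepClass.comap P.subtype x

theorem Fixes.symm {x : RepClass S} {P Q : Subgroup S} {e : P ≃* Q} (h : Fixes x e) :
    Fixes x e.symm := by
  have := congrArg (RepClass.comap e.symm.toMonoidHom) h
  rw [RepClass.comap_comap, RepClass.comap_comap] at this
  refine (this.symm.trans ?_)
  congr 2
  ext y
  simp

theorem Fixes.trans {x : RepClass S} {P Q R : Subgroup S} {e : P ≃* Q} {f : Q ≃* R}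
    (h : Fixes x e) (h' : Fixes x f) : Fixes x (e.trans f) := by
  have := congrArg (RepClass.comap e.toMonoidHom) h'
  rw [RepClass.comap_comap, RepClass.comap_comap] at this
  exact this.trans h

theorem Fixes.restrict {x : RepClass S} {P Q N R : Subgroup S} {e : P ≃* Q} {f : N ≃* R}
    (h : Fixes x f) (hPN : P ≤ N) (hef : ∀ y : P, (e y : S) = f ⟨y, hPN y.2⟩) : Fixes x e := by
  have := congrArg (RepClass.comap (Subgroup.inclusion hPN)) h
  rw [RepClass.comap_comap, RepClass.comap_comap] at this
  refine Eq.trans ?_ this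
  unfold Fixes at *
  congr 2
  ext y
  exact hef y

theorem IsIso.toTop {P Q : Subgroup S} {e : P ≃* Q} (h : F.IsIso e) :
    (Subgroup.inclusion le_top).comp e.toMonoidHom ∈ F.Hom P ⊤ :=
  F.comp_mem h.1 (F.conj_mem 1 _ (by simp))

theorem range_toTop {P Q : Subgroup S} (e : P ≃* Q) :
    (((Subgroup.inclusion (le_top : Q ≤ ⊤)).comp e.toMonoidHom).range.map (Subgroup.subtype ⊤))
      = Q := by
  ext y
  simp only [Subgroup.mem_map, MonoidHom.mem_range]
  constructor
  · rintro ⟨_, ⟨z, rfl⟩, rfl⟩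
    exact (e z).2
  · intro hy
    exact ⟨⟨y, trivial⟩, ⟨e.symm ⟨y, hy⟩, by ext; simp⟩, rfl⟩

/-- Every isomorphism onto a fully centralized subgroup is fixed, if it extends to a larger
subgroup and all the isomorphisms of larger subgroups are fixed. -/
theorem fixes_of_extender (hF : F.IsSaturated) {x : RepClass S} {P Q : Subgroup S}
    (IH : ∀ N R : Subgroup S, P < N → ∀ e : N ≃* R, F.IsIso e → Fixes x e)
    (e : P ≃* Q) (he : F.IsIso e) (hQ : F.FullyCentralized Q)
    (hlt : P < extender (Q.subtype.comp e.toMonoidHom)) : Fixes x e := by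
  obtain ⟨ψ, hψ, hext⟩ := hF.extend P _ (IsIso.toTop F he) (by rw [range_toTop]; exact hQ)
  obtain ⟨R, hR, f, hf, hf', hψf⟩ := F.factor hψ
  have h1 := IH _ R (by exact hlt) f ⟨hf, hf'⟩
  refine h1.restrict hlt.le fun y => ?_
  have h2 := congrArg (Subtype.val) (hext y y.2 (hlt.le y.2))
  rw [hψf] at h2
  exact h2.symm

theorem IsConj.card_eq {P Q : Subgroup S} (h : F.IsConj P Q) : Nat.card P = Nat.card Q :=
  Nat.card_congr h.choose.toEquiv

theorem exists_fullyNormalized (P : Subgroup S) :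
    ∃ R, F.IsConj P R ∧ F.FullyNormalized R := by
  have := F.finite
  obtain ⟨R, hR, hmax⟩ := Set.exists_max_image {R | F.IsConj P R}
    (fun R => Nat.card (Subgroup.normalizer (R : Set S))) (Set.toFinite _)
    ⟨P, _, F.isIso_refl P⟩
  refine ⟨R, hR, fun P' hP' => hmax P' ?_⟩
  obtain ⟨e, he⟩ := hR
  obtain ⟨f, hf⟩ := hP'
  exact ⟨_, he.trans hf⟩

theorem lt_normalizer (F : FusionSystem p S) [Fact p.Prime] {P : Subgroup S} (h : P ≠ ⊤) :
    P < Subgroup.normalizer (P : Set S) := by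
  have := F.finite
  have := F.isPGroup.isNilpotent
  exact Group.normalizerCondition_of_isNilpotent P (lt_top_iff_ne_top.2 h)

theorem mem_extender {P Q : Subgroup S} {e : P ≃* Q} {g h : S}
    (hg : g ∈ Subgroup.normalizer (P : Set S))
    (hh : ∀ (y : S) (hy : y ∈ P) (hy' : g * y * g⁻¹ ∈ P),
      (e ⟨g * y * g⁻¹, hy'⟩ : S) = h * e ⟨y, hy⟩ * h⁻¹) :
    g ∈ extender (Q.subtype.comp e.toMonoidHom) :=
  ⟨hg, h, fun y => hh y y.2 _⟩

/-- Any subgroup `P` has an isomorphism in `F`, fixed by the restrictions of `x`, to a given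
conjugate that is fully normalized. -/
theorem exists_fixed_iso [Fact p.Prime] (hF : F.IsSaturated) {x : RepClass S}
    {P R : Subgroup S} (hP : P ≠ ⊤) (hR : F.FullyNormalized R) (h : F.IsConj P R)
    (IH : ∀ N R : Subgroup S, P < N → ∀ e : N ≃* R, F.IsIso e → Fixes x e) :
    ∃ e : P ≃* R, F.IsIso e ∧ Fixes x e := by
  have := F.finite
  obtain ⟨χ, hχ⟩ := h
  obtain ⟨T, hT⟩ := hF.sylow R hR
  -- the `p`-subgroup `χ Aut_S(P) χ⁻¹` of `Aut_F(R)`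
  let c : Subgroup.normalizer (P : Set S) →* F.autF R :=
    { toFun := fun g => ⟨(χ.symm.trans (P.normalizerMonoidHom g)).trans χ,
        (hχ.symm.trans ⟨F.conj_mem g _ fun _ => rfl,
          F.conj_mem (g : S)⁻¹ _ fun y => by
            obtain ⟨z, rfl⟩ := (P.normalizerMonoidHom g).surjective y
            simp [mul_assoc]⟩).trans hχ⟩
      map_one' := by ext y; simp
      map_mul' := fun g g' => by ext y; simp }
  have hc : IsPGroup p c.range :=
    (F.isPGroup.to_subgroup (Subgroup.normalizer (P : Set S))).of_surjective c.rangeRestrict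
      c.rangeRestrict_surjective
  obtain ⟨T', hT'⟩ := hc.exists_le_sylow
  obtain ⟨β, hβ⟩ := MulAction.exists_smul_eq (F.autF R) T' T
  have key : ∀ g, β * c g * β⁻¹ ∈ (autS R).subgroupOf (F.autF R) := fun g => by
    rw [← hT, ← hβ]
    exact Subgroup.smul_mem_pointwise_smul (c g) (MulAut.conj β) _ (hT' ⟨g, rfl⟩)
  refine ⟨χ.trans β.1, hχ.trans β.2, ?_⟩
  refine F.fixes_of_extender hF IH _ (hχ.trans β.2) (hF.fullyCentralized R hR) ?_
  refine lt_of_lt_of_le (F.lt_normalizer hP) fun g hg => ?_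
  obtain ⟨k, hk⟩ := key ⟨g, hg⟩
  refine mem_extender (h := (k : S)) hg fun y hy hy' => ?_
  have h2 : R.normalizerMonoidHom k (β.1 (χ ⟨y, hy⟩))
      = (β.1 * (c ⟨g, hg⟩).1 * β.1⁻¹) (β.1 (χ ⟨y, hy⟩)) := DFunLike.congr_fun hk _
  rw [MulAut.mul_apply, MulAut.inv_apply_self, MulAut.mul_apply] at h2
  have h3 : (c ⟨g, hg⟩).1 (χ ⟨y, hy⟩) = χ ⟨g * y * g⁻¹, hy'⟩ := by
    change χ (P.normalizerMonoidHom ⟨g, hg⟩ (χ.symm (χ ⟨y, hy⟩))) = _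
    rw [MulEquiv.symm_apply_apply]
    rfl
  rw [h3] at h2
  exact (congrArg Subtype.val h2).symm

/-- A form of Alperin's fusion theorem: if the restrictions of `x` are fixed by the isomorphisms
between centric subgroups, they are fixed by all the isomorphisms. -/
theorem fixes_of_centric [Fact p.Prime] (hF : F.IsSaturated) {x : RepClass S}
    (hx : ∀ P Q : Subgroup S, F.IsCentric P → ∀ e : P ≃* Q, F.IsIso e → Fixes x e)
    (P Q : Subgroup S) (e : P ≃* Q) (he : F.IsIso e) : Fixes x e := by
  have := F.finite
  induction hn : Nat.card S - Nat.card P using Nat.strong_induction_on generalizing P Q with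
  | _ n IH =>
    have IH' : ∀ P' : Subgroup S, Nat.card P' = Nat.card P → ∀ N R : Subgroup S, P' < N →
        ∀ e : N ≃* R, F.IsIso e → Fixes x e := fun P' hP' N R hN f hf => by
      have h1 : Nat.card P' < Nat.card N := by
        by_contra hge
        exact hN.ne (Subgroup.eq_of_le_of_card_ge hN.le (not_lt.1 hge))
      have h2 : Nat.card N ≤ Nat.card S := Subgroup.card_le_card_group N
      exact IH (Nat.card S - Nat.card N) (by omega) N R f hf rfl
    by_cases hc : F.IsCentric P
    · exact hx P Q hc e he
    have htop : ∀ P' : Subgroup S, F.IsConj P P' → P' ≠ ⊤ := by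
      rintro P' hP' rfl
      refine hc fun P'' hP'' => ?_
      have h1 : P'' = ⊤ := by
        apply Subgroup.eq_top_of_card_eq
        rw [← IsConj.card_eq F hP'', IsConj.card_eq F hP', Subgroup.card_top]
      rw [h1]
      exact le_top
    obtain ⟨R, hPR, hR⟩ := F.exists_fullyNormalized P
    have hQP : F.IsConj Q P := ⟨e.symm, he.symm⟩
    have hQR : F.IsConj Q R := by
      obtain ⟨f, hf⟩ := hPR
      exact ⟨_, he.symm.trans hf⟩
    obtain ⟨e₁, he₁, hx₁⟩ := F.exists_fixed_iso hF (htop P ⟨_, F.isIso_refl P⟩) hR hPR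
      (IH' P rfl)
    obtain ⟨e₂, he₂, hx₂⟩ := F.exists_fixed_iso hF (htop Q ⟨e, he⟩) hR hQR
      (IH' Q (IsConj.card_eq F hQP))
    have hRc := hF.fullyCentralized R hR
    -- `R` does not contain its centralizer
    have hCR : ¬ Subgroup.centralizer (R : Set S) ≤ R := fun hle => by
      refine hc fun P' hP' => ?_
      obtain ⟨f, hf⟩ := hP'
      have hi := he₁.symm.trans hf
      set i := e₁.symm.trans f with hidef
      have h1 := hRc P' ⟨_, hi⟩
      have hcent : ∀ y : Subgroup.centralizer (R : Set S),
          (i ⟨y, hle y.2⟩ : S) ∈ Subgroup.centralizer (P' : Set S) ⊓ P' := fun y => by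
        refine ⟨fun z hz => ?_, (i _).2⟩
        have h3 := y.2 _ (i.symm ⟨z, hz⟩).2
        have h4 : i.symm ⟨z, hz⟩ * ⟨y, hle y.2⟩ = ⟨y, hle y.2⟩ * i.symm ⟨z, hz⟩ :=
          Subtype.ext h3
        have h5 := congrArg (fun w => (i w : S)) h4
        simpa using h5
      have h2 : Nat.card (Subgroup.centralizer (R : Set S))
          ≤ Nat.card (Subgroup.centralizer (P' : Set S) ⊓ P' : Subgroup S) := by
        refine Nat.card_le_card_of_injective (fun y =>
          (⟨_, hcent y⟩ : (Subgroup.centralizer (P' : Set S) ⊓ P' : Subgroup S))) fun y z hyz => ?_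
        have h0 := congrArg Subtype.val hyz
        have h3 := i.injective (Subtype.ext h0)
        exact Subtype.ext (Subtype.mk.inj h3)
      exact inf_eq_left.1 (Subgroup.eq_of_le_of_card_ge inf_le_left (h1.trans h2))
    let χ : R ≃* R := e₁.symm.trans (e.trans e₂)
    have hχ : F.IsIso χ := he₁.symm.trans (he.trans he₂)
    have hlt : R < extender (R.subtype.comp χ.toMonoidHom) := by
      have hle : R ≤ extender (R.subtype.comp χ.toMonoidHom) := fun g hg =>
        mem_extender (h := χ ⟨g, hg⟩) (Subgroup.le_normalizer hg) fun y hy hy' => by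
          have : (⟨g * y * g⁻¹, hy'⟩ : R) = ⟨g, hg⟩ * ⟨y, hy⟩ * ⟨g, hg⟩⁻¹ := rfl
          rw [this, map_mul, map_mul, map_inv]
          rfl
      refine lt_of_le_of_ne hle fun heq => hCR fun g hg => ?_
      rw [heq]
      have hcomm : ∀ y ∈ R, g * y * g⁻¹ = y := fun y hy => by
        rw [← hg y hy, mul_inv_cancel_right]
      refine mem_extender (h := 1) (fun y => ⟨fun hy => ?_, fun hy => ?_⟩) fun y hy hy' => ?_
      · exact (hcomm y hy).symm ▸ hy
      · have h1 := hcomm _ hy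
        have h2 : y = g * y * g⁻¹ := by
          calc y = g⁻¹ * (g * y * g⁻¹) * g := by group
            _ = g⁻¹ * (g * (g * y * g⁻¹) * g⁻¹) * g := by rw [h1]
            _ = g * y * g⁻¹ := by group
        rw [h2]
        exact hy
      · simp only [hcomm y hy]
        simp
    have hxχ : Fixes x χ :=
      F.fixes_of_extender hF (IH' R (IsConj.card_eq F hPR).symm) χ hχ hRc hlt
    have hfin := hx₁.trans (hxχ.trans hx₂.symm)
    have : e₁.trans (χ.trans e₂.symm) = e := by
      ext y
      simp [χ]
    rwa [this] at hfin

/-- A class is invariant as soon as it is invariant under the morphisms between centric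
subgroups. -/
theorem isInvariant_of_centric [Fact p.Prime] (hF : F.IsSaturated) {x : RepClass S}
    (hx : ∀ P Q : Subgroup S, F.IsCentric P → F.IsCentric Q → ∀ f ∈ F.Hom P Q,
      RepClass.comap (Q.subtype.comp f) x = RepClass.comap P.subtype x) :
    F.IsInvariant x := by
  intro P f hf
  obtain ⟨R, hR, e, he, he', rfl⟩ := F.factor hf
  refine F.fixes_of_centric hF (fun P Q hP e he => hx P Q hP ?_ _ he.1) P R e ⟨he, he'⟩
  rintro P' ⟨g, hg⟩
  exact hP P' ⟨_, he.trans hg⟩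

end FusionSystem


/-! ### Central extensions and twisted representations -/

/-- A normalized `2`-cocycle of `S` with values in the trivial `S`-module `A`, written
multiplicatively. -/
structure TwoCocycle (S A : Type u) [Group S] [CommGroup A] where
  toFun : S → S → A
  one_left : ∀ s, toFun 1 s = 1
  one_right : ∀ s, toFun s 1 = 1
  cocycle : ∀ s t r, toFun s t * toFun (s * t) r = toFun t r * toFun s (t * r)

namespace TwoCocycle

variable {S A : Type u} [Group S] [CommGroup A]

/-- The set underlying the central extension `S_α` of `S` by `A`: pairs `(a, s)`. -/
@[ext]
structure Ext (α : TwoCocycle S A) : Type u where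
  fst : A
  snd : S

variable (α : TwoCocycle S A)

instance : Mul α.Ext := ⟨fun x y => ⟨x.fst * y.fst * α.toFun x.snd y.snd, x.snd * y.snd⟩⟩

instance : One α.Ext := ⟨⟨1, 1⟩⟩

instance : Inv α.Ext := ⟨fun x => ⟨(x.fst * α.toFun x.snd⁻¹ x.snd)⁻¹, x.snd⁻¹⟩⟩

/-- The group structure `(a, s) (b, t) = (a b α(s, t), s t)` of `S_α`. -/
instance : Group α.Ext :=
  Group.ofLeftAxioms
    (fun x y z => Ext.ext (by
      change x.fst * y.fst * α.toFun x.snd y.snd * z.fst * α.toFun (x.snd * y.snd) z.snd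
        = x.fst * (y.fst * z.fst * α.toFun y.snd z.snd) * α.toFun x.snd (y.snd * z.snd)
      have h := α.cocycle x.snd y.snd z.snd
      calc _ = x.fst * y.fst * z.fst *
            (α.toFun x.snd y.snd * α.toFun (x.snd * y.snd) z.snd) := by
            simp only [mul_assoc, mul_left_comm, mul_comm]
        _ = _ := by rw [h]; simp only [mul_assoc])
      (mul_assoc x.snd y.snd z.snd))
    (fun x => Ext.ext (by
      change 1 * x.fst * α.toFun 1 x.snd = x.fst
      rw [α.one_left, one_mul, mul_one]) (one_mul x.snd))
    (fun x => Ext.ext (by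
      change (x.fst * α.toFun x.snd⁻¹ x.snd)⁻¹ * x.fst * α.toFun x.snd⁻¹ x.snd = 1
      rw [mul_assoc, inv_mul_cancel]) (inv_mul_cancel x.snd))

/-- The inclusion of `A` in `S_α`. -/
def emb : A →* α.Ext where
  toFun a := ⟨a, 1⟩
  map_one' := rfl
  map_mul' a b := Ext.ext (by
    change a * b = a * b * α.toFun 1 1
    rw [α.one_left, mul_one]) (one_mul 1).symm

/-- The projection of `S_α` to `S`. -/
def proj : α.Ext →* S where
  toFun x := x.snd
  map_one' := rfl
  map_mul' _ _ := rfl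

theorem proj_emb (a : A) : α.proj (α.emb a) = 1 := rfl

theorem exists_emb {x : α.Ext} (hx : α.proj x = 1) : ∃ a, α.emb a = x :=
  ⟨x.fst, Ext.ext rfl hx.symm⟩

end TwoCocycle

/-- The center of a fusion system: the limit over the centric subgroups `P` of the centers `Z(P)`,
seen as the subgroup of the elements of `Z(S)` (which belong to `Z(P)` for every centric `P`) that
are fixed by all the morphisms between centric subgroups. -/
def FusionSystem.center {p : ℕ} {S : Type u} [Group S] (F : FusionSystem p S) : Subgroup S where
  carrier := {z | z ∈ Subgroup.center S ∧ ∀ (P Q : Subgroup S), F.IsCentric P → F.IsCentric Q →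
    ∀ f ∈ F.Hom P Q, ∀ hz : z ∈ P, (f ⟨z, hz⟩ : S) = z}
  one_mem' := ⟨one_mem _, fun P Q _ _ f _ hz => congrArg Subtype.val (map_one f)⟩
  mul_mem' := by
    rintro y z ⟨hy, hy'⟩ ⟨hz, hz'⟩
    refine ⟨mul_mem hy hz, fun P Q hP hQ f hf h => ?_⟩
    have h1 : y ∈ P := hP P ⟨_, F.isIso_refl P⟩ (Subgroup.center_le_centralizer _ hy)
    have h2 : z ∈ P := hP P ⟨_, F.isIso_refl P⟩ (Subgroup.center_le_centralizer _ hz)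
    have h3 := congrArg Subtype.val (map_mul f ⟨y, h1⟩ ⟨z, h2⟩)
    exact h3.trans (congrArg₂ (· * ·) (hy' P Q hP hQ f hf h1) (hz' P Q hP hQ f hf h2))
  inv_mem' := by
    rintro y ⟨hy, hy'⟩
    refine ⟨inv_mem hy, fun P Q hP hQ f hf h => ?_⟩
    have h1 : y ∈ P := by simpa using inv_mem h
    have h3 := congrArg Subtype.val (map_inv f ⟨y, h1⟩)
    exact h3.trans (congrArg (·⁻¹) (hy' P Q hP hQ f hf h1))

theorem FusionSystem.center_le_of_isCentric {p : ℕ} {S : Type u} [Group S] (F : FusionSystem p S)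
    {P : Subgroup S} (hP : F.IsCentric P) {z : S} (hz : z ∈ F.center) : z ∈ P :=
  hP P ⟨_, F.isIso_refl P⟩ (Subgroup.center_le_centralizer _ hz.1)

/-- A central extension `F_α` of the fusion system `F` by `A` over the group `S_α`: a saturated
fusion system over `S_α`, whose center contains `A`, such that the quotient fusion system
`F_α / A` over `S_α / A = S` is `F`. The morphisms `P → Q` of `F_α / A` are the homomorphisms
induced by the morphisms of `F_α` between the inverse images of `P` and `Q`. -/
structure CentralExtension {p : ℕ} {S A : Type u} [Group S] [CommGroup A] (F : FusionSystem p S)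
    (α : TwoCocycle S A) where
  total : FusionSystem p α.Ext
  saturated : total.IsSaturated
  central : ∀ a, α.emb a ∈ total.center
  quotient : ∀ (P Q : Subgroup S) (φ : P →* Q), φ ∈ F.Hom P Q ↔
    ∃ ψ ∈ total.Hom (P.comap α.proj) (Q.comap α.proj),
      ∀ x : P.comap α.proj, (φ ⟨α.proj x, x.2⟩ : S) = α.proj (ψ x)

section ARep

variable {S A : Type u} [Group S] [CommGroup A] {α : TwoCocycle S A} (ι : A →* Circle)

/-- The class of a representation of a group `G` with a homomorphism `j : G → S_α` is an
`A`-representation if the elements of `G` over `a ∈ A ⊆ S_α` act as multiplication by the complex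
number `ι a`. -/
def IsARep {G : Type u} [Group G] (j : G →* α.Ext) (x : RepClass G) : Prop :=
  ∃ (n : ℕ) (ρ : Representation ℂ G (Fin n → ℂ)), RepClass.cls ρ = x ∧
    ∀ (g : G) (a : A), j g = α.emb a → ∀ v, ρ g v = (ι a : ℂ) • v

theorem isARep_cls {G : Type u} [Group G] (j : G →* α.Ext) {V : Type*} [AddCommGroup V]
    [Module ℂ V] [FiniteDimensional ℂ V] (ρ : Representation ℂ G V) :
    IsARep ι j (RepClass.cls ρ) ↔
      ∀ (g : G) (a : A), j g = α.emb a → ∀ v, ρ g v = (ι a : ℂ) • v := by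
  constructor
  · rintro ⟨n, σ, h, hσ⟩ g a hga v
    obtain ⟨e⟩ := RepClass.cls_eq_iff.1 h
    obtain ⟨w, rfl⟩ := e.toLinearEquiv.surjective v
    rw [← RepClass.equiv_apply, hσ g a hga, map_smul]
  · intro h
    refine ⟨_, (FinRep.ofRep ρ).ρ, RepClass.cls_eq_iff.2 ⟨(FinRep.ofRepEquiv ρ).symm⟩,
      fun g a hga v => ?_⟩
    obtain ⟨w, rfl⟩ := (FinRep.ofRepEquiv ρ).toLinearEquiv.surjective v
    rw [← RepClass.equiv_apply, h g a hga, map_smul]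

/-- The monoid of isomorphism classes of `A`-representations of `G`. -/
noncomputable def ARep {G : Type u} [Group G] (j : G →* α.Ext) : AddSubmonoid (RepClass G) where
  carrier := {x | IsARep ι j x}
  zero_mem' := (isARep_cls ι j _).2 fun _ _ _ _ => Subsingleton.elim _ _
  add_mem' := by
    rintro _ _ ⟨m, ρ, rfl, hρ⟩ ⟨n, σ, rfl, hσ⟩
    change IsARep ι j _
    rw [RepClass.cls_add, isARep_cls]
    exact fun g a h v => Prod.ext (hρ g a h v.1) (hσ g a h v.2)

theorem ARep.mul_mem {G : Type u} [Group G] (j : G →* α.Ext) {x : RepClass G} (hx : x ∈ ARep ι j)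
    (y : RepClass S) : RepClass.comap (α.proj.comp j) y * x ∈ ARep ι j := by
  obtain ⟨m, ρ, rfl, hρ⟩ := hx
  induction y using RepClass.ind with
  | h n σ =>
    change IsARep ι j _
    rw [RepClass.comap_cls, RepClass.cls_mul, isARep_cls]
    intro g a h v
    have h1 : σ (α.proj (j g)) = 1 := by rw [h, α.proj_emb, map_one]
    have h2 : ρ g = (ι a : ℂ) • LinearMap.id := LinearMap.ext (hρ g a h)
    change TensorProduct.map (σ (α.proj (j g))) (ρ g) v = _
    rw [h1, h2, TensorProduct.map_smul_right]
    change (ι a : ℂ) • (TensorProduct.map LinearMap.id LinearMap.id) v = _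
    rw [TensorProduct.map_id]
    rfl

/-- Representations of `S` act on `A`-representations by the tensor product
`V • W = V ⊗ W`, where `G` acts on `V` through `G → S_α → S`. -/
noncomputable instance ARep.instModule {G : Type u} [Group G] (j : G →* α.Ext)
    (T : Subsemiring (RepClass S)) : Module T (ARep ι j) where
  smul y x := ⟨RepClass.comap (α.proj.comp j) y * x, ARep.mul_mem ι j x.2 y⟩
  one_smul x := Subtype.ext (by
    change RepClass.comap (α.proj.comp j) (1 : RepClass S) * (x : RepClass G) = x
    rw [map_one, one_mul])
  mul_smul y z x := Subtype.ext (by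
    change RepClass.comap (α.proj.comp j) ((y : RepClass S) * z) * (x : RepClass G) = _ * (_ * _)
    rw [map_mul, mul_assoc])
  smul_zero y := Subtype.ext (mul_zero _)
  smul_add y x x' := Subtype.ext (mul_add _ _ _)
  add_smul y z x := Subtype.ext (by
    change RepClass.comap (α.proj.comp j) ((y : RepClass S) + z) * (x : RepClass G) = _ * _ + _ * _
    rw [map_add, add_mul])
  zero_smul x := Subtype.ext (by
    change RepClass.comap (α.proj.comp j) (0 : RepClass S) * (x : RepClass G) = 0
    rw [map_zero, zero_mul])

theorem ARep.comap_mem {G H : Type u} [Group G] [Group H] (j : G →* α.Ext) (k : H →* α.Ext)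
    (f : G →* H) (hf : ∀ g a, j g = α.emb a → k (f g) = α.emb a) {x : RepClass H}
    (hx : x ∈ ARep ι k) : RepClass.comap f x ∈ ARep ι j := by
  obtain ⟨m, ρ, rfl, hρ⟩ := hx
  change IsARep ι j _
  rw [RepClass.comap_cls, isARep_cls]
  exact fun g a h v => hρ (f g) a (hf g a h) v

/-- Restriction of `A`-representations along `f : G → H`, as a linear map over a semiring of
representations of `S` on which the two ways of restricting to `G` agree. -/
noncomputable def ARep.comapLinear {G H : Type u} [Group G] [Group H] (j : G →* α.Ext)
    (k : H →* α.Ext) (T : Subsemiring (RepClass S)) (f : G →* H)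
    (hf : ∀ g a, j g = α.emb a → k (f g) = α.emb a)
    (hT : ∀ y ∈ T, RepClass.comap ((α.proj.comp k).comp f) y = RepClass.comap (α.proj.comp j) y) :
    ARep ι k →ₗ[T] ARep ι j where
  toFun x := ⟨RepClass.comap f x, ARep.comap_mem ι j k f hf x.2⟩
  map_add' x y := Subtype.ext (map_add (RepClass.comap f) _ _)
  map_smul' y x := Subtype.ext (by
    change RepClass.comap f (RepClass.comap (α.proj.comp k) (y : RepClass S) * (x : RepClass H))
      = RepClass.comap (α.proj.comp j) (y : RepClass S) * RepClass.comap f x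
    rw [map_mul, RepClass.comap_comap, hT y y.2])

end ARep

/-! ### The orbit category of centric subgroups -/

namespace FusionSystem

variable {p : ℕ} {S : Type u} [Group S]

/-- The objects of the orbit category `Or(F^c)`: the `F`-centric subgroups of `S`. -/
structure OrbitCat (F : FusionSystem p S) : Type u where
  subgroup : Subgroup S
  isCentric : F.IsCentric subgroup

/-- Two morphisms `P → Q` are identified in the orbit category if they differ by an inner
automorphism of `Q`. -/
def orbitSetoid (F : FusionSystem p S) (P Q : Subgroup S) : Setoid (F.Hom P Q) where
  r f g := ∃ q : Q, ∀ x, g.1 x = q * f.1 x * q⁻¹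
  iseqv :=
    { refl := fun _ => ⟨1, fun x => by simp⟩
      symm := fun ⟨q, hq⟩ => ⟨q⁻¹, fun x => by rw [hq]; group⟩
      trans := fun ⟨q, hq⟩ ⟨r, hr⟩ => ⟨r * q, fun x => by rw [hr, hq]; group⟩ }

/-- The orbit category `Or(F^c)`, with `Hom(P, Q) = Hom_F(P, Q) / Inn(Q)`. -/
instance (F : FusionSystem p S) : CategoryTheory.SmallCategory F.OrbitCat where
  Hom P Q := Quotient (F.orbitSetoid P.subgroup Q.subgroup)
  id P := Quotient.mk _ ⟨MonoidHom.id _, (F.isIso_refl P.subgroup).1⟩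
  comp {P Q R} := Quotient.map₂ (sa := F.orbitSetoid P.subgroup Q.subgroup)
    (sb := F.orbitSetoid Q.subgroup R.subgroup) (sc := F.orbitSetoid P.subgroup R.subgroup)
    (fun f g => ⟨g.1.comp f.1, F.comp_mem f.2 g.2⟩) (by
      rintro f f' ⟨q, hq⟩ g g' ⟨r, hr⟩
      refine ⟨r * g.1 q, fun x => ?_⟩
      change g'.1 (f'.1 x) = r * g.1 q * g.1 (f.1 x) * (r * g.1 q)⁻¹
      rw [hr, hq, map_mul, map_mul, map_inv]
      group)
  id_comp f := by
    induction f using Quotient.ind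
    rfl
  comp_id f := by
    induction f using Quotient.ind
    rfl
  assoc f g h := by
    induction f using Quotient.ind
    induction g using Quotient.ind
    induction h using Quotient.ind
    rfl

end FusionSystem

namespace CentralExtension

open CategoryTheory

variable {p : ℕ} {S A : Type u} [Group S] [CommGroup A] {F : FusionSystem p S}
  {α : TwoCocycle S A} (E : CentralExtension F α) (ι : A →* Circle)

/-- The pull back to centric subgroups of `S_α` of an `F`-invariant representation is compatible
with the morphisms of `F_α`. -/
theorem comap_proj_eq {P Q : Subgroup α.Ext} (hP : E.total.IsCentric P) (hQ : E.total.IsCentric Q)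
    {f : P →* Q} (hf : f ∈ E.total.Hom P Q) {y : RepClass S} (hy : F.IsInvariant y) :
    RepClass.comap ((α.proj.comp Q.subtype).comp f) y = RepClass.comap (α.proj.comp P.subtype) y := by
  have key : ∀ R : Subgroup α.Ext, E.total.IsCentric R →
      (R.map α.proj).comap α.proj = R := fun R hR => by
    refine le_antisymm (fun x hx => ?_) (Subgroup.le_comap_map _ _)
    obtain ⟨r, hr, hrx⟩ := hx
    obtain ⟨a, ha⟩ := α.exists_emb (x := x * r⁻¹) (by rw [map_mul, map_inv, hrx, mul_inv_cancel])
    have h1 : x = α.emb a * r := by rw [ha]; group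
    rw [h1]
    exact mul_mem (E.total.center_le_of_isCentric hR (E.central a)) hr
  obtain ⟨P', rfl⟩ : ∃ P' : Subgroup S, P = P'.comap α.proj := ⟨_, (key P hP).symm⟩
  obtain ⟨Q', rfl⟩ : ∃ Q' : Subgroup S, Q = Q'.comap α.proj := ⟨_, (key Q hQ).symm⟩
  have hker : ∀ x : P'.comap α.proj, α.proj x = 1 → α.proj (f x) = 1 := fun x hx => by
    obtain ⟨a, ha⟩ := α.exists_emb hx
    have h1 := (E.central a).2 _ _ hP hQ f hf (ha ▸ x.2)
    have h2 : f x = f ⟨α.emb a, ha ▸ x.2⟩ := congrArg f (Subtype.ext ha.symm)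
    rw [h2, h1, α.proj_emb]
  let π : P'.comap α.proj →* P' := α.proj.subgroupComap P'
  have hπ : Function.Surjective π := fun y => ⟨⟨⟨1, y⟩, y.2⟩, rfl⟩
  let φ : P' →* Q' := (π.liftOfSurjective hπ) ⟨(α.proj.subgroupComap Q').comp f, fun x hx =>
    Subtype.ext (hker x (congrArg Subtype.val hx))⟩
  have hφ : ∀ x, φ (π x) = α.proj.subgroupComap Q' (f x) := fun x =>
    π.liftOfRightInverse_comp_apply _ _ _ x
  have hφF : φ ∈ F.Hom P' Q' :=
    (E.quotient P' Q' φ).2 ⟨f, hf, fun x => congrArg Subtype.val (hφ x)⟩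
  have h1 := hy P' ((Subgroup.inclusion le_top).comp φ) (F.comp_mem hφF (F.conj_mem 1 _ (by simp)))
  have h2 := congrArg (RepClass.comap π) h1
  rw [RepClass.comap_comap, RepClass.comap_comap] at h2
  refine Eq.trans ?_ h2
  congr 2
  ext x
  exact congrArg Subtype.val (hφ x).symm

/-- The monoid `Rep(F_α; A)` of isomorphism classes of `F_α`-invariant `A`-representations of
`S_α`. -/
noncomputable def RepA : AddSubmonoid (RepClass α.Ext) :=
  ARep ι (MonoidHom.id α.Ext) ⊓ E.total.Rep.toAddSubmonoid

/-- The tensor product of an `F`-invariant representation of `S` and an `F_α`-invariant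
`A`-representation of `S_α` is an `F_α`-invariant `A`-representation. -/
theorem mul_mem_repA [Fact p.Prime] {y : RepClass S} (hy : y ∈ F.Rep) {x : RepClass α.Ext}
    (hx : x ∈ E.RepA ι) : RepClass.comap α.proj y * x ∈ E.RepA ι := by
  refine ⟨ARep.mul_mem ι (MonoidHom.id α.Ext) hx.1 y, E.total.Rep.mul_mem ?_ hx.2⟩
  refine E.total.isInvariant_of_centric E.saturated fun P Q hP hQ f hf => ?_
  rw [RepClass.comap_comap, RepClass.comap_comap]
  exact E.comap_proj_eq hP hQ hf hy

/-- The action of `Rep(F)` on `Rep(F_α; A)` by the tensor product `V • W = V ⊗ W`, where `S_α` acts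
on `V` through `S_α → S`. -/
noncomputable instance instModule [Fact p.Prime] : Module F.Rep (E.RepA ι) where
  smul y x := ⟨RepClass.comap α.proj y * x, E.mul_mem_repA ι y.2 x.2⟩
  one_smul x := Subtype.ext (by
    change RepClass.comap α.proj (1 : RepClass S) * (x : RepClass α.Ext) = x
    rw [map_one, one_mul])
  mul_smul y z x := Subtype.ext (by
    change RepClass.comap α.proj ((y : RepClass S) * z) * (x : RepClass α.Ext) = _ * (_ * _)
    rw [map_mul, mul_assoc])
  smul_zero y := Subtype.ext (mul_zero _)
  smul_add y x x' := Subtype.ext (mul_add _ _ _)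
  add_smul y z x := Subtype.ext (by
    change RepClass.comap α.proj ((y : RepClass S) + z) * (x : RepClass α.Ext) = _ * _ + _ * _
    rw [map_add, add_mul])
  zero_smul x := Subtype.ext (by
    change RepClass.comap α.proj (0 : RepClass S) * (x : RepClass α.Ext) = 0
    rw [map_zero, zero_mul])

/-- The group `R(F_α; A)`, a module over `R(F)`. -/
abbrev RA : Type u := Algebra.GrothendieckAddGroup (E.RepA ι)

/-- The group `R(Q; A)` for a subgroup `Q` of `S_α`, a module over `R(F)`. -/
abbrev RSub (_ : CentralExtension F α) (ι : A →* Circle) (Q : Subgroup α.Ext) : Type u :=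
  Algebra.GrothendieckAddGroup (ARep ι Q.subtype)

/-- The restriction map `R(F_α; A) → R(Q; A)`. -/
noncomputable def restrict [Fact p.Prime] (Q : Subgroup α.Ext) : E.RA ι →ₗ[F.R] E.RSub ι Q :=
  Groth.mapLinear
    { toFun := fun x => ⟨RepClass.comap Q.subtype x,
        ARep.comap_mem ι Q.subtype (MonoidHom.id α.Ext) Q.subtype (fun _ _ h => h) x.2.1⟩
      map_add' := fun x y => Subtype.ext (map_add (RepClass.comap Q.subtype) _ _)
      map_smul' := fun y x => Subtype.ext (by
        change RepClass.comap Q.subtype (RepClass.comap α.proj (y : RepClass S) *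
            (x : RepClass α.Ext))
          = RepClass.comap (α.proj.comp Q.subtype) (y : RepClass S) * RepClass.comap Q.subtype x
        rw [map_mul, RepClass.comap_comap]) }

/-- The map `f^* : Rep(Q; A) → Rep(P; A)` for a morphism `f : P → Q` of `F_α` between centric
subgroups. -/
noncomputable def pullback {P Q : E.total.OrbitCat} (f : E.total.Hom P.subgroup Q.subgroup) :
    ARep ι Q.subgroup.subtype →ₗ[F.Rep] ARep ι P.subgroup.subtype :=
  ARep.comapLinear ι P.subgroup.subtype Q.subgroup.subtype F.Rep f.1
    (fun g a h => by
      have h1 := (E.central a).2 _ _ P.isCentric Q.isCentric f.1 f.2 (h ▸ g.2)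
      exact (congrArg (fun w => (f.1 w : α.Ext)) (Subtype.ext h)).trans h1)
    (fun _ hy => E.comap_proj_eq P.isCentric Q.isCentric f.2 hy)

/-- The map `f^* : R(Q; A) → R(P; A)` for a morphism `f : P → Q` of the orbit category. -/
noncomputable def orbitMap {P Q : E.total.OrbitCat} (f : P ⟶ Q) :
    E.RSub ι Q.subgroup →ₗ[F.R] E.RSub ι P.subgroup :=
  Quotient.lift (s := E.total.orbitSetoid P.subgroup Q.subgroup)
    (fun g => Groth.mapLinear (E.pullback ι g))
    (by
      rintro g g' ⟨q, hq⟩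
      refine congrArg Groth.mapLinear (LinearMap.ext fun x => Subtype.ext ?_)
      exact (RepClass.comap_conj g.1 g'.1 q hq x).symm) f

theorem orbitMap_id (P : E.total.OrbitCat) : E.orbitMap ι (𝟙 P) = LinearMap.id := by
  change Groth.mapLinear _ = _
  refine Eq.trans (congrArg Groth.mapLinear (LinearMap.ext fun x => Subtype.ext ?_))
    Groth.mapLinear_id
  exact RepClass.comap_id _

theorem orbitMap_comp {P Q R : E.total.OrbitCat} (f : P ⟶ Q) (g : Q ⟶ R) :
    E.orbitMap ι (f ≫ g) = E.orbitMap ι f ∘ₗ E.orbitMap ι g := by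
  induction f using Quotient.ind
  induction g using Quotient.ind
  change Groth.mapLinear _ = Groth.mapLinear _ ∘ₗ Groth.mapLinear _
  rw [Groth.mapLinear_comp]
  refine congrArg Groth.mapLinear (LinearMap.ext fun x => Subtype.ext ?_)
  exact (RepClass.comap_comap _ _ _).symm

/-- The contravariant functor `Q ↦ R(Q; A)` from the orbit category of `F_α`-centric subgroups to
modules over `R(F)`, which sends a morphism `f` to the restriction along `f`. -/
noncomputable def repFunctor : E.total.OrbitCatᵒᵖ ⥤ ModuleCat.{u} F.R where
  obj Q := ModuleCat.of F.R (E.RSub ι Q.unop.subgroup)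
  map f := ModuleCat.ofHom (E.orbitMap ι f.unop)
  map_id Q := congrArg ModuleCat.ofHom (E.orbitMap_id ι Q.unop)
  map_comp f g := congrArg ModuleCat.ofHom (E.orbitMap_comp ι g.unop f.unop)

end CentralExtension

/-!
The orbit category of centric subgroups contains `S_α` itself, and every object maps to it, so an
element of the limit is the same thing as a virtual `A`-representation `[V] - [W]` of `S_α` that is
stable: its restrictions along any two morphisms from a centric subgroup agree. The map from
`R(F_α; A)` to the limit is therefore the map that forgets invariance, and the claim is that it is
injective, and that every stable virtual `A`-representation is a difference of invariant ones.

Both halves rest on the fact that representations of a finite group are determined by their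
characters (`RepClass.char_injective`), so that isomorphism classes of representations can be
cancelled in direct sums. This gives injectivity at once (`restrict_top_injective`).

For surjectivity, it is enough to find a `Y` with `W ⊕ Y` invariant: then `V ⊕ Y` is invariant too,
since `[V ⊕ Y] = ([V] - [W]) + [W ⊕ Y]` is stable. Such a `Y` is found inside `ℂ[S] ⊗ W`, where `S_α`
acts on the regular representation `ℂ[S]` through `S`. It contains `W` because `ℂ[S]` contains the
trivial representation. It is invariant (`isInvariant_regular_mul`) because its character vanishes
outside `A`, while a morphism of `F_α` between centric subgroups fixes every element of `A` and, being
injective, sends no other element into `A`. By Alperin's fusion theorem, in the form of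
`FusionSystem.isInvariant_of_centric`, invariance under these morphisms suffices.
-/

/-! ### Characters of isomorphism classes of representations -/

namespace RepClass

section Character

variable {G : Type u} [Group G]

/-- The character of an isomorphism class of representations. -/
noncomputable def char (x : RepClass G) : G → ℂ :=
  Quotient.lift (s := FinRep.setoid G) (fun V => V.ρ.character)
    (fun _ _ ⟨e⟩ => Representation.char_iso e) x

theorem char_cls {V : Type v} [AddCommGroup V] [Module ℂ V] [FiniteDimensional ℂ V]
    (ρ : Representation ℂ G V) : (cls ρ).char = ρ.character :=
  (Representation.char_iso (FinRep.ofRepEquiv ρ)).symm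

theorem char_add (x y : RepClass G) : (x + y).char = x.char + y.char := by
  induction x using ind with
  | h m ρ =>
    induction y using ind with
    | h n σ =>
      rw [cls_add, char_cls, char_cls, char_cls]
      exact funext fun g => LinearMap.trace_prodMap' (ρ g) (σ g)

theorem char_mul (x y : RepClass G) : (x * y).char = x.char * y.char := by
  induction x using ind with
  | h m ρ =>
    induction y using ind with
    | h n σ => rw [cls_mul, char_cls, char_cls, char_cls, Representation.char_tensor]

theorem char_comap {H : Type*} [Group H] (φ : G →* H) (x : RepClass H) :
    (comap φ x).char = x.char ∘ φ := by
  induction x using ind with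
  | h n ρ =>
    rw [comap_cls, char_cls, char_cls]
    rfl

/-- By Maschke's theorem, a representation that embeds in another one is a direct summand of it. -/
theorem exists_cls_eq_add [Finite G] {V W : Type*} [AddCommGroup V] [Module ℂ V]
    [FiniteDimensional ℂ V] [AddCommGroup W] [Module ℂ W] [FiniteDimensional ℂ W]
    {ρ : Representation ℂ G V} {σ : Representation ℂ G W} (f : ρ.IntertwiningMap σ)
    (hf : Function.Injective f) : ∃ z, cls σ = cls ρ + z := by
  obtain ⟨q, hq⟩ := exists_isCompl f.range
  have hdisj : ∀ w, w ∈ f.range → w ∈ q → w = 0 := fun w hw hw' => by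
    have h : f.range ⊓ q ≤ ⊥ := hq.disjoint.le_bot
    exact h (show w ∈ f.range ⊓ q from ⟨hw, hw'⟩)
  have hspan : ∀ w, ∃ v : V, ∃ u ∈ q, f v + u = w := fun w => by
    have h : ⊤ ≤ f.range ⊔ q := hq.codisjoint.top_le
    have hw : w ∈ f.range.toSubmodule ⊔ q.toSubmodule :=
      h (show w ∈ (⊤ : Subrepresentation σ) from trivial)
    obtain ⟨_, ⟨v, rfl⟩, u, hu, huw⟩ := Submodule.mem_sup.1 hw
    exact ⟨v, u, hu, huw⟩
  refine ⟨cls q.toRepresentation, ?_⟩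
  rw [cls_add]
  refine (cls_eq_iff.2 ⟨?_⟩).symm
  refine .mk (LinearEquiv.ofBijective (f.toLinearMap.coprod q.toSubmodule.subtype) ⟨?_, ?_⟩)
    fun g => LinearMap.ext fun x => ?_
  · rw [← LinearMap.ker_eq_bot, LinearMap.ker_eq_bot']
    rintro ⟨v, u, hu⟩ h
    have h1 : f v + u = 0 := h
    have h2 : u = 0 := hdisj u ⟨-v, by rw [← neg_eq_of_add_eq_zero_right h1]; exact map_neg f v⟩ hu
    subst h2
    rw [add_zero] at h1
    exact Prod.ext (hf (h1.trans (map_zero f).symm)) rfl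
  · intro w
    obtain ⟨v, u, hu, h⟩ := hspan w
    exact ⟨(v, ⟨u, hu⟩), h⟩
  · change f (ρ g x.1) + σ g x.2 = σ g (f x.1 + x.2)
    rw [map_add, f.isIntertwining]

/-- A nonzero intertwining map exhibits a nonzero common direct summand of its source and its
target. -/
theorem exists_common_summand [Finite G] {V W : Type*} [AddCommGroup V] [Module ℂ V]
    [FiniteDimensional ℂ V] [AddCommGroup W] [Module ℂ W] [FiniteDimensional ℂ W]
    {ρ : Representation ℂ G V} {σ : Representation ℂ G W} (f : ρ.IntertwiningMap σ) (hf : f ≠ 0) :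
    ∃ t x y : RepClass G, t.char 1 ≠ 0 ∧ cls ρ = t + x ∧ cls σ = t + y := by
  obtain ⟨q, hq⟩ := exists_isCompl f.ker
  have hdisj : ∀ v ∈ q, f v = 0 → v = 0 := fun v hv hv' => by
    have h : f.ker ⊓ q ≤ ⊥ := hq.disjoint.le_bot
    exact h (show v ∈ f.ker ⊓ q from ⟨hv', hv⟩)
  let i : q.toRepresentation.IntertwiningMap ρ := ⟨q.toSubmodule.subtype, fun _ => rfl⟩
  obtain ⟨x, hx⟩ := exists_cls_eq_add i Subtype.val_injective
  obtain ⟨y, hy⟩ := exists_cls_eq_add (f.comp i) (by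
    refine (injective_iff_map_eq_zero (f.comp i)).2 fun v hv => Subtype.ext ?_
    exact hdisj v v.2 hv)
  refine ⟨cls q.toRepresentation, x, y, ?_, hx, hy⟩
  rw [char_cls, Representation.char_one, Nat.cast_ne_zero]
  intro h0
  refine hf (Representation.IntertwiningMap.ext (LinearMap.ext fun v => ?_))
  have hq0 : q.toSubmodule = ⊥ := Submodule.finrank_eq_zero.1 h0
  have h : ⊤ ≤ f.ker ⊔ q := hq.codisjoint.top_le
  have hv : v ∈ f.ker.toSubmodule ⊔ q.toSubmodule :=
    h (show v ∈ (⊤ : Subrepresentation ρ) from trivial)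
  rw [hq0, sup_bot_eq] at hv
  exact hv

theorem char_cls_one {V : Type*} [AddCommGroup V] [Module ℂ V] [FiniteDimensional ℂ V]
    (ρ : Representation ℂ G V) : (cls ρ).char 1 = Module.finrank ℂ V := by
  rw [char_cls, Representation.char_one]

/-- Representations of a finite group are determined by their characters. If `ρ` and `σ` have the
same character, then `dim Hom(ρ, σ) = dim Hom(ρ, ρ)`, so that nonzero `ρ` and `σ` have a nonzero
common summand; it is split off, and induction on the dimension applies to the complements. -/
theorem char_injective [Finite G] : Function.Injective (char : RepClass G → G → ℂ) := by
  have key : ∀ (d : ℕ) (x y : RepClass G), x.char 1 = d → x.char = y.char → x = y := by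
    intro d
    induction d using Nat.strong_induction_on with
    | _ d IH =>
      intro x y hd hxy
      induction x using ind with
      | h m ρ =>
        induction y using ind with
        | h n σ =>
          rcases Nat.eq_zero_or_pos d with rfl | hpos
          · have h1 := hxy ▸ hd
            rw [char_cls_one, Nat.cast_inj, Module.finrank_fin_fun] at hd h1
            subst hd h1
            rw [cls_eq_zero, cls_eq_zero]
          have := Fintype.ofFinite G
          have : Invertible (Nat.card G : ℂ) :=
            invertibleOfNonzero (Nat.cast_ne_zero.2 Nat.card_pos.ne')
          -- the dimension of `Hom(ρ, σ)` is the scalar product of the characters, which is the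
          -- dimension of `Hom(ρ, ρ)`
          have hρσ : Module.finrank ℂ (ρ.IntertwiningMap σ)
              = Module.finrank ℂ (ρ.IntertwiningMap ρ) := by
            have h := hxy
            rw [char_cls, char_cls] at h
            rw [← Nat.cast_inj (R := ℂ),
              ← Representation.card_inv_mul_sum_char_mul_char_eq_finrank,
              ← Representation.card_inv_mul_sum_char_mul_char_eq_finrank, h]
          have hm : m = d := by
            rwa [char_cls_one, Nat.cast_inj, Module.finrank_fin_fun] at hd
          obtain ⟨f, hf⟩ : ∃ f : ρ.IntertwiningMap σ, f ≠ 0 := by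
            by_contra! h0
            have : Subsingleton (ρ.IntertwiningMap σ) := ⟨fun a b => (h0 a).trans (h0 b).symm⟩
            rw [Module.finrank_zero_of_subsingleton] at hρσ
            have := Module.finrank_zero_iff.1 hρσ.symm
            have h1 := Subsingleton.elim (Representation.IntertwiningMap.id ρ) 0
            have h2 := DFunLike.congr_fun h1 (fun _ => 1)
            exact one_ne_zero (congrFun h2 ⟨0, hm ▸ hpos⟩)
          obtain ⟨t, x, y, ht, hx, hy⟩ := exists_common_summand f hf
          rw [hx, hy, char_add, char_add, add_right_inj] at hxy
          rw [hx, char_add, Pi.add_apply] at hd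
          rw [hx, hy]
          induction t using ind with
          | h k τ =>
            clear hx
            induction x using ind with
            | h l ξ =>
              rw [char_cls_one, char_cls_one, ← Nat.cast_add, Nat.cast_inj] at hd
              rw [char_cls_one, Nat.cast_ne_zero] at ht
              rw [IH _ (by omega) _ y (char_cls_one ξ) hxy]
  intro x y hxy
  obtain ⟨d, hd⟩ : ∃ d : ℕ, x.char 1 = d := by
    induction x using ind with
    | h n ρ => exact ⟨_, char_cls_one ρ⟩
  exact key d x y hd hxy

instance [Finite G] : IsCancelAdd (RepClass G) :=
  have : IsLeftCancelAdd (RepClass G) := ⟨fun x y z h => char_injective (by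
    have h1 := congrArg char h
    simp only [char_add] at h1
    exact add_left_cancel h1)⟩
  AddCommMagma.IsLeftCancelAdd.toIsCancelAdd _

end Character

section Regular

variable (S : Type u) [Group S]

/-- The regular representation of `S` on the functions on `S`, by `(s f) x = f (x s)`. -/
def regularRep : Representation ℂ S (S → ℂ) where
  toFun s := LinearMap.funLeft ℂ ℂ (· * s)
  map_one' := LinearMap.ext fun f => funext fun x => congrArg f (mul_one x)
  map_mul' s t := LinearMap.ext fun f => funext fun x => congrArg f (mul_assoc x s t).symm

/-- The isomorphism class of the regular representation. -/
noncomputable def regular [Finite S] : RepClass S := cls (regularRep S)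

variable {S}

theorem char_regular_of_ne_one [Finite S] {s : S} (hs : s ≠ 1) : (regular S).char s = 0 := by
  classical
  have := Fintype.ofFinite S
  rw [regular, char_cls]
  change LinearMap.trace ℂ (S → ℂ) (regularRep S s) = 0
  rw [LinearMap.trace_eq_matrix_trace ℂ (Pi.basisFun ℂ S)]
  refine Finset.sum_eq_zero fun x _ => ?_
  rw [Matrix.diag_apply, LinearMap.toMatrix_apply, Pi.basisFun_apply, Pi.basisFun_repr]
  exact Pi.single_eq_of_ne (fun h => hs (mul_eq_left.1 h)) _

/-- The constant functions are a trivial summand of the regular representation. -/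
theorem exists_regular_eq_one_add [Finite S] : ∃ y : RepClass S, regular S = 1 + y := by
  let f : (Representation.trivial ℂ S ℂ).IntertwiningMap (regularRep S) :=
    ⟨LinearMap.pi fun _ => LinearMap.id, fun _ => rfl⟩
  exact exists_cls_eq_add f fun a b h => congrFun h 1

end Regular

end RepClass

/-! ### Grothendieck groups of cancellative monoids -/

namespace Groth

open Algebra

theorem exists_eq_of_sub_of {M : Type*} [AddCommMonoid M] (x : GrothendieckAddGroup M) :
    ∃ m n : M, x = GrothendieckAddGroup.of m - GrothendieckAddGroup.of n := by
  induction x using induction with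
  | of m => exact ⟨m, 0, by rw [map_zero, sub_zero]⟩
  | sub a b ha hb =>
    obtain ⟨m, n, rfl⟩ := ha
    obtain ⟨k, l, rfl⟩ := hb
    exact ⟨m + l, n + k, by rw [map_add, map_add]; abel⟩

theorem map_injective {M N : Type*} [AddCommMonoid M] [AddCommMonoid N] [IsCancelAdd N]
    {f : M →+ N} (hf : Function.Injective f) : Function.Injective (map f) := by
  refine (injective_iff_map_eq_zero _).2 fun x => ?_
  obtain ⟨m, n, rfl⟩ := exists_eq_of_sub_of x
  rw [map_sub, map_of, map_of, sub_eq_zero, sub_eq_zero]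
  exact fun h => congrArg _ (hf (GrothendieckAddGroup.of_injective h))

end Groth

/-! ### Invariant `A`-representations -/

namespace FusionSystem

variable {p : ℕ} {S : Type u} [Group S]

theorem inclusion_mem (F : FusionSystem p S) {P Q : Subgroup S} (h : P ≤ Q) :
    Subgroup.inclusion h ∈ F.Hom P Q :=
  F.conj_mem 1 _ fun x => by rw [one_mul, inv_one, mul_one, Subgroup.coe_inclusion]

theorem isCentric_top (F : FusionSystem p S) : F.IsCentric ⊤ := fun P' hP' => by
  have := F.finite
  have h : P' = ⊤ := Subgroup.eq_top_of_card_eq _ (by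
    rw [← hP'.card_eq F, Subgroup.card_top])
  rw [h]
  exact le_top

/-- The group `S`, as an object of the orbit category. -/
def OrbitCat.top (F : FusionSystem p S) : F.OrbitCat := ⟨⊤, F.isCentric_top⟩

end FusionSystem

namespace CentralExtension

open CategoryTheory Algebra

variable {p : ℕ} {S A : Type u} [Group S] [CommGroup A] {F : FusionSystem p S}
  {α : TwoCocycle S A} (E : CentralExtension F α) (ι : A →* Circle)

/-- The tensor product of any representation with the regular representation of `S` is
`F_α`-invariant: its character vanishes outside `A`, and the morphisms of `F_α` between centric
subgroups fix `A` and preserve its complement. -/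
theorem isInvariant_regular_mul [Fact p.Prime] [Finite S] (x : RepClass α.Ext) :
    E.total.IsInvariant (RepClass.comap α.proj (RepClass.regular S) * x) := by
  have := E.total.finite
  refine E.total.isInvariant_of_centric E.saturated fun P Q hP hQ f hf => ?_
  refine RepClass.char_injective (funext fun g => ?_)
  have hfix : ∀ (a : A) (h : α.emb a ∈ P), (f ⟨α.emb a, h⟩ : α.Ext) = α.emb a := fun a h =>
    (E.central a).2 P Q hP hQ f hf h
  rw [RepClass.char_comap, RepClass.char_comap, RepClass.char_mul, RepClass.char_comap]
  change (RepClass.regular S).char (α.proj (f g)) * x.char (f g)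
    = (RepClass.regular S).char (α.proj g) * x.char g
  by_cases hg : α.proj g = 1
  · obtain ⟨a, ha⟩ := α.exists_emb hg
    have h1 : (f g : α.Ext) = g := by
      rw [← ha, ← hfix a (ha ▸ g.2)]
      exact congrArg (fun w => (f w : α.Ext)) (Subtype.ext ha.symm)
    rw [h1]
  · have hfg : α.proj (f g) ≠ 1 := fun h => hg (by
      obtain ⟨a, ha⟩ := α.exists_emb h
      have haP : α.emb a ∈ P := E.total.center_le_of_isCentric hP (E.central a)
      have h1 : (⟨α.emb a, haP⟩ : P) = g :=
        E.total.injective hf (Subtype.ext ((hfix a haP).trans ha))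
      rw [← h1, α.proj_emb])
    rw [RepClass.char_regular_of_ne_one hg, RepClass.char_regular_of_ne_one hfg, zero_mul, zero_mul]

/-- Every `A`-representation of `S_α` is a direct summand of an `F_α`-invariant one. -/
theorem exists_add_mem_repA [Fact p.Prime] {x : RepClass α.Ext}
    (hx : x ∈ ARep ι (MonoidHom.id α.Ext)) :
    ∃ y ∈ ARep ι (MonoidHom.id α.Ext), x + y ∈ E.RepA ι := by
  have := F.finite
  obtain ⟨y, hy⟩ := RepClass.exists_regular_eq_one_add (S := S)
  have h : x + RepClass.comap (α.proj.comp (MonoidHom.id α.Ext)) y * x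
      = RepClass.comap (α.proj.comp (MonoidHom.id α.Ext)) (RepClass.regular S) * x := by
    rw [hy, map_add, map_one, add_mul, one_mul]
  refine ⟨_, ARep.mul_mem ι (MonoidHom.id α.Ext) hx y, ?_⟩
  rw [h]
  exact ⟨ARep.mul_mem ι (MonoidHom.id α.Ext) hx _, E.isInvariant_regular_mul x⟩

/-! ### The comparison with the limit -/

/-- The inclusion of a centric subgroup in `S_α`, in the orbit category. -/
def toTop (Q : E.total.OrbitCat) :
    E.total.Hom Q.subgroup (FusionSystem.OrbitCat.top E.total).subgroup :=
  ⟨Subgroup.inclusion le_top, E.total.inclusion_mem le_top⟩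

theorem orbitMap_mk_of {P Q : E.total.OrbitCat} (f : E.total.Hom P.subgroup Q.subgroup)
    (x : ARep ι Q.subgroup.subtype) :
    E.orbitMap ι (P := P) (Q := Q) (Quotient.mk _ f) (GrothendieckAddGroup.of x)
      = GrothendieckAddGroup.of (E.pullback ι f x) :=
  Groth.mapLinear_of _ _

theorem orbitMap_mk_sub {P Q : E.total.OrbitCat} (f : E.total.Hom P.subgroup Q.subgroup)
    (x y : ARep ι Q.subgroup.subtype) :
    E.orbitMap ι (P := P) (Q := Q) (Quotient.mk _ f)
        (GrothendieckAddGroup.of x - GrothendieckAddGroup.of y)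
      = GrothendieckAddGroup.of (E.pullback ι f x) - GrothendieckAddGroup.of (E.pullback ι f y) := by
  rw [map_sub, orbitMap_mk_of, orbitMap_mk_of]

theorem π_eq_orbitMap_π_top (z : (Limits.limit (E.repFunctor ι) : ModuleCat F.R))
    {P Q : E.total.OrbitCat} (f : P ⟶ Q) :
    E.orbitMap ι f (Limits.limit.π (E.repFunctor ι) (Opposite.op Q) z)
      = Limits.limit.π (E.repFunctor ι) (Opposite.op P) z :=
  ConcreteCategory.congr_hom (Limits.limit.w (E.repFunctor ι) f.op) z

variable [Fact p.Prime]

theorem orbitMap_restrict {P Q : E.total.OrbitCat} (f : P ⟶ Q) (x : E.RA ι) :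
    E.orbitMap ι f (E.restrict ι Q.subgroup x) = E.restrict ι P.subgroup x := by
  induction f using Quotient.ind with
  | _ f =>
    refine LinearMap.congr_fun (f := E.orbitMap ι (P := P) (Q := Q) (Quotient.mk _ f) ∘ₗ
      E.restrict ι Q.subgroup) (Groth.linear_ext fun m => ?_) x
    rw [LinearMap.comp_apply]
    unfold restrict
    rw [Groth.mapLinear_of, Groth.mapLinear_of, orbitMap_mk_of]
    refine congrArg _ (Subtype.ext ?_)
    change RepClass.comap f.1 (RepClass.comap Q.subgroup.subtype (m : RepClass α.Ext)) = _
    rw [RepClass.comap_comap]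
    exact m.2.2 P.subgroup ((Subgroup.inclusion le_top).comp f.1)
      (E.total.comp_mem f.2 (E.total.inclusion_mem le_top))

/-- The cone over `Q ↦ R(Q; A)` given by the restriction maps from `R(F_α; A)`. -/
noncomputable def restrictCone : Limits.Cone (E.repFunctor ι) where
  pt := ModuleCat.of F.R (E.RA ι)
  π :=
    { app := fun Q => ModuleCat.ofHom (E.restrict ι Q.unop.subgroup)
      naturality := fun P Q f => by
        refine ModuleCat.hom_ext (LinearMap.ext fun x => ?_)
        exact (E.orbitMap_restrict ι f.unop x).symm }

/-- Invariant representations that become equal in `R(S_α; A)` are isomorphic, since isomorphism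
classes of representations form a cancellative monoid. -/
theorem restrict_top_injective : Function.Injective (E.restrict ι ⊤) := by
  have := E.total.finite
  refine Groth.map_injective fun x y h => Subtype.ext ?_
  have h1 : RepClass.comap (Subgroup.subtype ⊤) (x : RepClass α.Ext)
    = RepClass.comap (Subgroup.subtype ⊤) (y : RepClass α.Ext) := congrArg Subtype.val h
  have h2 := congrArg (RepClass.comap Subgroup.topEquiv.symm.toMonoidHom) h1
  rw [RepClass.comap_comap, RepClass.comap_comap] at h2
  exact (RepClass.comap_id _).symm.trans (h2.trans (RepClass.comap_id _))

/-- An element of `R(S_α; A)` whose restrictions along the morphisms of `F_α` from any centric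
subgroup agree comes from `R(F_α; A)`. Such a virtual representation is `[V] - [W]`; if `W ⊕ Y` is
invariant, then so is `V ⊕ Y`, because the difference of the two is stable and restrictions can be
compared by cancellation. -/
theorem exists_restrict_top_eq (z : E.RSub ι (FusionSystem.OrbitCat.top E.total).subgroup)
    (hz : ∀ (P : E.total.OrbitCat) (f g : P ⟶ FusionSystem.OrbitCat.top E.total),
      E.orbitMap ι f z = E.orbitMap ι g z) :
    ∃ x : E.RA ι, E.restrict ι ⊤ x = z := by
  have := E.total.finite
  obtain ⟨v, w, rfl⟩ : ∃ v w : ARep ι (Subgroup.subtype (⊤ : Subgroup α.Ext)),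
      z = GrothendieckAddGroup.of v - GrothendieckAddGroup.of w := Groth.exists_eq_of_sub_of z
  let e : α.Ext →* (⊤ : Subgroup α.Ext) := Subgroup.topEquiv.symm.toMonoidHom
  have he : ∀ u : RepClass (⊤ : Subgroup α.Ext),
      RepClass.comap (Subgroup.subtype ⊤) (RepClass.comap e u) = u := fun u =>
    (RepClass.comap_comap _ _ _).trans (RepClass.comap_id u)
  have hmem : ∀ u : ARep ι (Subgroup.subtype (⊤ : Subgroup α.Ext)),
      RepClass.comap e u ∈ ARep ι (MonoidHom.id α.Ext) := fun u =>
    ARep.comap_mem ι _ (Subgroup.subtype ⊤) e (fun _ _ h => h) u.2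
  obtain ⟨y, hy, hwy⟩ := E.exists_add_mem_repA ι (hmem w)
  have hvy : RepClass.comap e v + y ∈ E.RepA ι := by
    refine ⟨add_mem (hmem v) hy, E.total.isInvariant_of_centric E.saturated
      fun P Q hP hQ f hf => ?_⟩
    let P' : E.total.OrbitCat := ⟨P, hP⟩
    let f' : E.total.Hom P'.subgroup (FusionSystem.OrbitCat.top E.total).subgroup :=
      ⟨(Subgroup.inclusion le_top).comp f, E.total.comp_mem hf (E.total.inclusion_mem le_top)⟩
    have h1 := (E.orbitMap_mk_sub ι f' v w).symm.trans
      ((hz P' (Quotient.mk _ f') (Quotient.mk _ (E.toTop P'))).trans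
        (E.orbitMap_mk_sub ι (E.toTop P') v w))
    rw [sub_eq_sub_iff_add_eq_add, ← map_add, ← map_add] at h1
    have h2 : RepClass.comap f'.1 (v : RepClass (⊤ : Subgroup α.Ext))
          + RepClass.comap (E.toTop P').1 (w : RepClass (⊤ : Subgroup α.Ext))
        = RepClass.comap (E.toTop P').1 (v : RepClass (⊤ : Subgroup α.Ext))
          + RepClass.comap f'.1 (w : RepClass (⊤ : Subgroup α.Ext)) :=
      congrArg Subtype.val (GrothendieckAddGroup.of_injective h1)
    have h3 := hwy.2 P f'.1 f'.2
    have hf' : ∀ u : RepClass (⊤ : Subgroup α.Ext),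
        RepClass.comap ((Subgroup.subtype ⊤).comp f'.1) (RepClass.comap e u)
          = RepClass.comap f'.1 u := fun u => RepClass.comap_comap _ _ _
    have hP' : ∀ u : RepClass (⊤ : Subgroup α.Ext),
        RepClass.comap P.subtype (RepClass.comap e u)
          = RepClass.comap (E.toTop P').1 u := fun u => RepClass.comap_comap _ _ _
    change RepClass.comap ((Subgroup.subtype ⊤).comp f'.1) _ = _
    rw [map_add, map_add, hf', hP'] at h3 ⊢
    -- `f^*v + w = v + f^*w` and `f^*w + f^*y = w + y` add up to `f^*v + f^*y = v + y`
    refine add_right_cancel (b := RepClass.comap (E.toTop P').1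
      (w : RepClass (⊤ : Subgroup α.Ext))) ?_
    rw [add_right_comm, h2, add_assoc, h3]
    abel
  refine ⟨GrothendieckAddGroup.of ⟨_, hvy⟩ - GrothendieckAddGroup.of ⟨_, hwy⟩, ?_⟩
  have hres : ∀ (u : ARep ι (Subgroup.subtype (⊤ : Subgroup α.Ext)))
      (hu : RepClass.comap e u + y ∈ E.RepA ι),
      E.restrict ι ⊤ (GrothendieckAddGroup.of ⟨_, hu⟩) = GrothendieckAddGroup.of u
        + GrothendieckAddGroup.of ⟨RepClass.comap (Subgroup.subtype ⊤) y,
          ARep.comap_mem ι (Subgroup.subtype ⊤) (MonoidHom.id α.Ext) (Subgroup.subtype ⊤)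
            (fun _ _ h => h) hy⟩ := fun u hu => by
    unfold restrict
    rw [Groth.mapLinear_of, ← map_add]
    refine congrArg _ (Subtype.ext ?_)
    change RepClass.comap (Subgroup.subtype ⊤) (RepClass.comap e u + y) = _
    rw [map_add, he]
    rfl
  rw [map_sub, hres, hres, add_sub_add_right_eq_sub]

end CentralExtension

theorem mainTheorem7 {p : ℕ} [Fact p.Prime] {S A : Type u} [Group S] [CommGroup A]
    [Finite A] [IsCyclic A] (hA : IsPGroup p A)
    (ι : A →* Circle) (hι : Function.Injective ι)
    (F : FusionSystem p S) (hF : F.IsSaturated) (α : TwoCocycle S A)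
    (E : CentralExtension F α) :
    ∃ e : E.RA ι ≃ₗ[F.R] (CategoryTheory.Limits.limit (E.repFunctor ι) : ModuleCat F.R),
      ∀ (Q : E.total.OrbitCat) (x : E.RA ι),
        CategoryTheory.Limits.limit.π (E.repFunctor ι) (Opposite.op Q) (e x)
          = E.restrict ι Q.subgroup x := by
  let l : E.RA ι →ₗ[F.R] (CategoryTheory.Limits.limit (E.repFunctor ι) : ModuleCat F.R) :=
    (CategoryTheory.Limits.limit.lift (E.repFunctor ι) (E.restrictCone ι)).hom
  have hl : ∀ (Q : E.total.OrbitCat) (x : E.RA ι),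
      CategoryTheory.Limits.limit.π (E.repFunctor ι) (Opposite.op Q) (l x)
        = E.restrict ι Q.subgroup x := fun Q x =>
    CategoryTheory.ConcreteCategory.congr_hom
      (CategoryTheory.Limits.limit.lift_π (E.restrictCone ι) (Opposite.op Q)) x
  let T := FusionSystem.OrbitCat.top E.total
  refine ⟨LinearEquiv.ofBijective l ⟨fun x y h => E.restrict_top_injective ι ?_, fun z => ?_⟩, hl⟩
  · exact (hl T x).symm.trans ((congrArg _ h).trans (hl T y))
  · obtain ⟨x, hx⟩ := E.exists_restrict_top_eq ι
      (CategoryTheory.Limits.limit.π (E.repFunctor ι) (Opposite.op T) z) fun P f g =>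
        (E.π_eq_orbitMap_π_top ι z f).trans (E.π_eq_orbitMap_π_top ι z g).symm
    -- an element of the limit is determined by its component at `S_α`, because every centric
    -- subgroup maps to `S_α` in the orbit category
    refine ⟨x, CategoryTheory.Limits.Concrete.limit_ext _ _ _ fun Q => ?_⟩
    let f : Q.unop ⟶ T := Quotient.mk _ (E.toTop Q.unop)
    refine (hl Q.unop x).trans ?_
    refine Eq.trans ?_ (E.π_eq_orbitMap_π_top ι z f)
    exact (E.orbitMap_restrict ι f x).symm.trans (congrArg _ hx)
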